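/- Let $(M,g)$ be a smooth Lorentzian manifold with a Witt structure $TM=(V_{p}\oplus V_{p^*})\overset{\perp}{\oplus}H$, that is: $V_p,V_{p^*},H$ are smooth subbundles with $TM=V_p\oplus V_{p^*}\oplus H$, $V_p$ and $V_{p^*}$ are null line subbundles in duality under $g$, $H$ is orthogonal to $V_p\oplus V_{p^*}$, and $g|_H$ is positive definite. Let $\xi,\xi^*$ be smooth vector fields with $\xi\in V_p$, $\xi^*\in V_{p^*}$, $g(\xi,\xi^*)=1$, and put $\sigma=g(\xi^*,\cdot)$, $\sigma^*=g(\xi,\cdot)$. Let $\nabla$ be the canonical Witt connection: the metric connection that preserves each $V_i$, $i\in\{p,p^*,q\}$ (where $V_q:=H$), and whose torsion is, for sections $X$ of $V_i$ and $Y$ of $V_j$, $$T(X,Y)=-\sum_{k\neq i,\,k\neq j}[X,Y]_k+\tau^j(X,Y)-\tau^i(Y,X).$$ Here $Z_k$ is the $V_k$-component of $Z$, $\flat,\sharp$ are the musical isomorphisms of $g$, $\mathcal L$ is the Lie derivative, and $\tau^j(X,Y)$ is $0$ if $i=j$; it is $\frac12\bigl((\mathcal L_XY^\flat+\mathcal L_YX^\flat)^\sharp_j-[X,Y]_j-(d(g(X,Y)))^\sharp_j\bigr)$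 if $\{i,j\}=\{p,p^*\}$; and it is $\frac12\bigl((\mathcal L_XY^\flat)^\sharp_j-[X,Y]_j\bigr)$ in the remaining cases. For $\lambda=(\lambda_1,\lambda_2)\in C^\infty(M,\mathbb R^2)$ let $\alpha^\lambda=\lambda_1\sigma+\lambda_2\sigma^*$ and, for a smooth curve $c:[0,1]\to M$, $$E^\lambda(c)=\frac12\int_0^1g(\dot c,\dot c)\,dt-\int_0^1\alpha^\lambda(\dot c)\,dt.$$ Let $c:[0,1]\to M$ be a smooth horizontal curve, i.e. $\dot c(t)\in H_{c(t)}$ for all $t$, and let $c_s(t)=F(s,t)$ be a variation of $c$ with fixed endpoints, i.e. $F:\,]-\epsilon,\epsilon[\,\times[0,1]\to M$ is smooth, $\epsilon>0$, $F(0,t)=c(t)$, $F(s,0)=c(0)$, $F(s,1)=c(1)$. Write $w(t)=\frac{\partial F}{\partial s}(0,t)$, $w_H$ for its $H$-component, and $\lambda_i^c=\lambda_i\circ c$. Then $s\mapsto E^\lambda(c_s)$ is differentiable at $s=0$, the integrand below is integrable on $[0,1]$, and $$\begin{aligned}\frac{\partial}{\partial s}E^{\lambda}(c_{s})\Big|_{s=0}=\int_{0}^{1}\Bigl[&-g(\nabla_{\dot{c}}\dot{c},w_H)+\lambda_{1}^{c}\,d\sigma(\dot{c},w_H)+\lambda_{2}^{c}\,d\sigma^*(\dot{c},w_H)\\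 &+\sigma(w)\bigl(\dot{\lambda_{1}^{c}}-\lambda_{1}^{c}(\mathcal L_{\xi}\sigma)(\dot{c})-\lambda_{2}^{c}(\mathcal L_{\xi}\sigma^*)(\dot{c})+\tfrac{1}{2}(\mathcal L_{\xi}g)(\dot{c},\dot{c})\bigr)\\ &+\sigma^*(w)\bigl(\dot{\lambda_{2}^{c}}-\lambda_{1}^{c}(\mathcal L_{\xi^*}\sigma)(\dot{c})-\lambda_{2}^{c}(\mathcal L_{\xi^*}\sigma^*)(\dot{c})+\tfrac{1}{2}(\mathcal L_{\xi^*}g)(\dot{c},\dot{c})\bigr)\Bigr]dt,\end{aligned}$$ with the convention $d\alpha(X,Y)=X(\alpha(Y))-Y(\alpha(X))-\alpha([X,Y])$. -/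

import Mathlib

open Bundle Set Manifold FiberBundle VectorField
open scoped ContDiff Topology

noncomputable section

set_option linter.unusedSectionVars false

namespace Witt

variable {E : Type*} [NormedAddCommGroup E] [NormedSpace ℝ E] [FiniteDimensional ℝ E]
  {M : Type*} [TopologicalSpace M] [ChartedSpace E M] [IsManifold 𝓘(ℝ, E) ∞ M]

/-! ### Tensors, Lie derivatives, exterior derivative -/

/-- The vector field `X` is smooth at the point `x`. -/
def SmoothFieldAt (X : Π x : M, TangentSpace 𝓘(ℝ, E) x) (x : M) : Prop :=
  ContMDiffAt 𝓘(ℝ, E) 𝓘(ℝ, E).tangent ∞ (fun y ↦ (⟨y, X y⟩ : TangentBundle 𝓘(ℝ, E) M)) x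

/-- The one-form `α` is smooth at `x₀` (as a section of the cotangent bundle). -/
def SmoothOneFormAt (α : Π x : M, TangentSpace 𝓘(ℝ, E) x →L[ℝ] ℝ) (x₀ : M) : Prop :=
  ContMDiffAt 𝓘(ℝ, E) (𝓘(ℝ, E).prod 𝓘(ℝ, E →L[ℝ] ℝ)) ∞
    (fun y ↦ TotalSpace.mk' (E →L[ℝ] ℝ) (E := fun y : M ↦ TangentSpace 𝓘(ℝ, E) y →L[ℝ] ℝ) y (α y))
    x₀

/-- The `(0,2)`-tensor field `g` is smooth. -/
def SmoothTwoTensor (g : Π x : M, TangentSpace 𝓘(ℝ, E) x →L[ℝ] TangentSpace 𝓘(ℝ, E) x →L[ℝ] ℝ) : Prop :=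
  ContMDiff 𝓘(ℝ, E) (𝓘(ℝ, E).prod 𝓘(ℝ, E →L[ℝ] E →L[ℝ] ℝ)) ∞
    (fun y ↦ TotalSpace.mk' (E →L[ℝ] E →L[ℝ] ℝ)
      (E := fun y : M ↦ TangentSpace 𝓘(ℝ, E) y →L[ℝ] TangentSpace 𝓘(ℝ, E) y →L[ℝ] ℝ) y (g y))

/-- `(L_X α)(Y) = X(α(Y)) - α([X,Y])`, for vector fields `X, Y`. -/
def lieFormAux (X : Π x : M, TangentSpace 𝓘(ℝ, E) x) (α : Π x : M, TangentSpace 𝓘(ℝ, E) x →L[ℝ] ℝ) (x : M)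
    (Y : Π x : M, TangentSpace 𝓘(ℝ, E) x) : ℝ :=
  mvfderiv 𝓘(ℝ, E) (fun y ↦ α y (Y y)) x (X x) - α x (mlieBracket 𝓘(ℝ, E) X Y x)

/-- `(L_Z g)(X,Y) = Z(g(X,Y)) - g([Z,X],Y) - g(X,[Z,Y])`, for vector fields `X, Y`. -/
def lieTensorAux (Z : Π x : M, TangentSpace 𝓘(ℝ, E) x) (g : Π x : M, TangentSpace 𝓘(ℝ, E) x →L[ℝ] TangentSpace 𝓘(ℝ, E) x →L[ℝ] ℝ) (x : M)
    (X Y : Π x : M, TangentSpace 𝓘(ℝ, E) x) : ℝ :=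
  mvfderiv 𝓘(ℝ, E) (fun y ↦ g y (X y) (Y y)) x (Z x)
    - g x (mlieBracket 𝓘(ℝ, E) Z X x) (Y x) - g x (X x) (mlieBracket 𝓘(ℝ, E) Z Y x)

/-- `dα(X,Y) = X(α(Y)) - Y(α(X)) - α([X,Y])`, for vector fields `X, Y`. -/
def extDAux (α : Π x : M, TangentSpace 𝓘(ℝ, E) x →L[ℝ] ℝ) (x : M) (X Y : Π x : M, TangentSpace 𝓘(ℝ, E) x) : ℝ :=
  mvfderiv 𝓘(ℝ, E) (fun y ↦ α y (Y y)) x (X x) - mvfderiv 𝓘(ℝ, E) (fun y ↦ α y (X y)) x (Y x)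
    - α x (mlieBracket 𝓘(ℝ, E) X Y x)

/-- A smooth one-form, evaluated on a differentiable vector field, is differentiable. -/
lemma SmoothOneFormAt.mdiff {α : Π x : M, TangentSpace 𝓘(ℝ, E) x →L[ℝ] ℝ} {x : M}
    (hα : SmoothOneFormAt α x)
    {Y : Π x : M, TangentSpace 𝓘(ℝ, E) x} (hY : MDiffAt (T% Y) x) :
    MDifferentiableAt 𝓘(ℝ, E) 𝓘(ℝ, ℝ) (fun y ↦ α y (Y y)) x := by
  have h : MDifferentiableAt 𝓘(ℝ, E) (𝓘(ℝ, E).prod 𝓘(ℝ, ℝ))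
      (fun m ↦ TotalSpace.mk' ℝ (E := Bundle.Trivial M ℝ) m (α m (Y m))) x := by
    apply MDifferentiableAt.clm_bundle_apply (F₁ := E)
    · exact hα.mdifferentiableAt (by simp)
    · exact hY
  simp only [mdifferentiableAt_totalSpace] at h
  exact h.2

/-- A smooth `(0,2)`-tensor, evaluated on differentiable vector fields, is differentiable. -/
lemma SmoothTwoTensor.mdiff {g : Π x : M, TangentSpace 𝓘(ℝ, E) x →L[ℝ] TangentSpace 𝓘(ℝ, E) x →L[ℝ] ℝ} (hg : SmoothTwoTensor g)
    {x : M} {X Y : Π x : M, TangentSpace 𝓘(ℝ, E) x} (hX : MDiffAt (T% X) x) (hY : MDiffAt (T% Y) x) :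
    MDifferentiableAt 𝓘(ℝ, E) 𝓘(ℝ, ℝ) (fun y ↦ g y (X y) (Y y)) x := by
  have h : MDifferentiableAt 𝓘(ℝ, E) (𝓘(ℝ, E).prod 𝓘(ℝ, ℝ))
      (fun m ↦ TotalSpace.mk' ℝ (E := Bundle.Trivial M ℝ) m (g m (X m) (Y m))) x := by
    apply MDifferentiableAt.clm_bundle_apply₂ (F₁ := E) (F₂ := E)
    · exact (hg x).mdifferentiableAt (by simp)
    · exact hX
    · exact hY
  simp only [mdifferentiableAt_totalSpace] at h
  exact h.2

lemma tensorial_lieFormAux {X : Π x : M, TangentSpace 𝓘(ℝ, E) x} {α : Π x : M, TangentSpace 𝓘(ℝ, E) x →L[ℝ] ℝ}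
    {x : M} (hα : SmoothOneFormAt α x) :
    TensorialAt 𝓘(ℝ, E) E (lieFormAux X α x) x where
  smul {f Y} hf hY := by
    have h1 : mvfderiv 𝓘(ℝ, E) (fun y ↦ α y ((f • Y) y)) x
        = f x • mvfderiv 𝓘(ℝ, E) (fun y ↦ α y (Y y)) x + (α x (Y x)) • mvfderiv 𝓘(ℝ, E) f x := by
      rw [← mvfderiv_mul hf (hα.mdiff hY)]
      congr 1
      ext y
      simp
    simp only [lieFormAux, h1, mlieBracket_smul_right hf hY]
    simp
    ring
  add {Y Y'} hY hY' := by
    have h1 : mvfderiv 𝓘(ℝ, E) (fun y ↦ α y ((Y + Y') y)) x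
        = mvfderiv 𝓘(ℝ, E) (fun y ↦ α y (Y y)) x + mvfderiv 𝓘(ℝ, E) (fun y ↦ α y (Y' y)) x := by
      rw [← mvfderiv_add (hα.mdiff hY) (hα.mdiff hY')]
      congr 1
      ext y
      simp
    simp only [lieFormAux, h1, mlieBracket_add_right hY hY']
    simp
    ring

lemma mvfderiv_tensor_smul {g : Π x : M, TangentSpace 𝓘(ℝ, E) x →L[ℝ] TangentSpace 𝓘(ℝ, E) x →L[ℝ] ℝ}
    (hg : SmoothTwoTensor g) {x : M} {X Y : Π x : M, TangentSpace 𝓘(ℝ, E) x} {f : M → ℝ}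
    (hf : MDiffAt f x) (hX : MDiffAt (T% X) x) (hY : MDiffAt (T% Y) x) :
    mvfderiv 𝓘(ℝ, E) (fun y ↦ g y ((f • X) y) (Y y)) x
      = f x • mvfderiv 𝓘(ℝ, E) (fun y ↦ g y (X y) (Y y)) x
        + (g x (X x) (Y x)) • mvfderiv 𝓘(ℝ, E) f x := by
  rw [← mvfderiv_mul hf (hg.mdiff hX hY)]
  congr 1
  ext y
  simp

lemma mvfderiv_tensor_smul_right {g : Π x : M, TangentSpace 𝓘(ℝ, E) x →L[ℝ] TangentSpace 𝓘(ℝ, E) x →L[ℝ] ℝ}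
    (hg : SmoothTwoTensor g) {x : M} {X Y : Π x : M, TangentSpace 𝓘(ℝ, E) x} {f : M → ℝ}
    (hf : MDiffAt f x) (hX : MDiffAt (T% X) x) (hY : MDiffAt (T% Y) x) :
    mvfderiv 𝓘(ℝ, E) (fun y ↦ g y (X y) ((f • Y) y)) x
      = f x • mvfderiv 𝓘(ℝ, E) (fun y ↦ g y (X y) (Y y)) x
        + (g x (X x) (Y x)) • mvfderiv 𝓘(ℝ, E) f x := by
  rw [← mvfderiv_mul hf (hg.mdiff hX hY)]
  congr 1
  ext y
  simp

lemma tensorial_lieTensorAux_left {Z : Π x : M, TangentSpace 𝓘(ℝ, E) x}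
    {g : Π x : M, TangentSpace 𝓘(ℝ, E) x →L[ℝ] TangentSpace 𝓘(ℝ, E) x →L[ℝ] ℝ}
    (hg : SmoothTwoTensor g) {x : M} {Y : Π x : M, TangentSpace 𝓘(ℝ, E) x}
    (hY : MDiffAt (T% Y) x) :
    TensorialAt 𝓘(ℝ, E) E (lieTensorAux Z g x · Y) x where
  smul {f X} hf hX := by
    simp only [lieTensorAux, mvfderiv_tensor_smul hg hf hX hY, mlieBracket_smul_right hf hX]
    simp
    ring
  add {X X'} hX hX' := by
    have h1 : mvfderiv 𝓘(ℝ, E) (fun y ↦ g y ((X + X') y) (Y y)) x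
        = mvfderiv 𝓘(ℝ, E) (fun y ↦ g y (X y) (Y y)) x
          + mvfderiv 𝓘(ℝ, E) (fun y ↦ g y (X' y) (Y y)) x := by
      rw [← mvfderiv_add (hg.mdiff hX hY) (hg.mdiff hX' hY)]
      congr 1
      ext y
      simp
    simp only [lieTensorAux, h1, mlieBracket_add_right hX hX']
    simp
    ring

lemma tensorial_lieTensorAux_right {Z : Π x : M, TangentSpace 𝓘(ℝ, E) x}
    {g : Π x : M, TangentSpace 𝓘(ℝ, E) x →L[ℝ] TangentSpace 𝓘(ℝ, E) x →L[ℝ] ℝ}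
    (hg : SmoothTwoTensor g) {x : M} {X : Π x : M, TangentSpace 𝓘(ℝ, E) x}
    (hX : MDiffAt (T% X) x) :
    TensorialAt 𝓘(ℝ, E) E (lieTensorAux Z g x X) x where
  smul {f Y} hf hY := by
    simp only [lieTensorAux, mvfderiv_tensor_smul_right hg hf hX hY, mlieBracket_smul_right hf hY]
    simp
    ring
  add {Y Y'} hY hY' := by
    have h1 : mvfderiv 𝓘(ℝ, E) (fun y ↦ g y (X y) ((Y + Y') y)) x
        = mvfderiv 𝓘(ℝ, E) (fun y ↦ g y (X y) (Y y)) x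
          + mvfderiv 𝓘(ℝ, E) (fun y ↦ g y (X y) (Y' y)) x := by
      rw [← mvfderiv_add (hg.mdiff hX hY) (hg.mdiff hX hY')]
      congr 1
      ext y
      simp
    simp only [lieTensorAux, h1, mlieBracket_add_right hY hY']
    simp
    ring

lemma extDAux_swap {α : Π x : M, TangentSpace 𝓘(ℝ, E) x →L[ℝ] ℝ} {x : M}
    (X Y : Π x : M, TangentSpace 𝓘(ℝ, E) x) : extDAux α x X Y = - extDAux α x Y X := by
  simp only [extDAux]
  rw [mlieBracket_swap_apply, map_neg]
  ring

lemma tensorial_extDAux_right {α : Π x : M, TangentSpace 𝓘(ℝ, E) x →L[ℝ] ℝ}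
    {x : M} (hα : SmoothOneFormAt α x) {X : Π x : M, TangentSpace 𝓘(ℝ, E) x} :
    TensorialAt 𝓘(ℝ, E) E (extDAux α x X) x where
  smul {f Y} hf hY := by
    have h := (tensorial_lieFormAux (X := X) hα).smul hf hY
    simp only [lieFormAux] at h
    simp only [extDAux]
    rw [sub_right_comm, h]
    simp
    ring
  add {Y Y'} hY hY' := by
    have h := (tensorial_lieFormAux (X := X) hα).add hY hY'
    simp only [lieFormAux] at h
    simp only [extDAux]
    rw [sub_right_comm, h]
    simp
    ring

lemma tensorial_extDAux_left {α : Π x : M, TangentSpace 𝓘(ℝ, E) x →L[ℝ] ℝ}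
    {x : M} (hα : SmoothOneFormAt α x) {Y : Π x : M, TangentSpace 𝓘(ℝ, E) x} :
    TensorialAt 𝓘(ℝ, E) E (extDAux α x · Y) x where
  smul {f X} hf hX := by
    simp only [extDAux_swap _ Y, (tensorial_extDAux_right (X := Y) hα).smul hf hX]
    simp
  add {X X'} hX hX' := by
    simp only [extDAux_swap _ Y, (tensorial_extDAux_right (X := Y) hα).add hX hX']
    ring

open Classical in
/-- The Lie derivative `L_X α` at `x`, as a covector: the value on `v` is
`X(α(Y)) - α([X,Y])` at `x` for any vector field `Y` with `Y x = v`. (The value `0` in the `else`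
branch is not used for smooth `α`, see `lieForm_apply`.) -/
def lieForm (X : Π x : M, TangentSpace 𝓘(ℝ, E) x) (α : Π x : M, TangentSpace 𝓘(ℝ, E) x →L[ℝ] ℝ)
    (x : M) : TangentSpace 𝓘(ℝ, E) x →L[ℝ] ℝ :=
  if h : TensorialAt 𝓘(ℝ, E) E (lieFormAux X α x) x then TensorialAt.mkHom _ x h else 0

lemma lieForm_apply {X Y : Π x : M, TangentSpace 𝓘(ℝ, E) x}
    {α : Π x : M, TangentSpace 𝓘(ℝ, E) x →L[ℝ] ℝ} {x : M} (hα : SmoothOneFormAt α x)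
    (hY : MDiffAt (T% Y) x) :
    lieForm X α x (Y x) = mvfderiv 𝓘(ℝ, E) (fun y ↦ α y (Y y)) x (X x)
      - α x (mlieBracket 𝓘(ℝ, E) X Y x) := by
  rw [lieForm, dif_pos (tensorial_lieFormAux hα)]
  exact TensorialAt.mkHom_apply _ hY

open Classical in
/-- The Lie derivative `L_Z g` at `x` of a `(0,2)`-tensor, as a bilinear form: the value on `(v,w)`
is `Z(g(X,Y)) - g([Z,X],Y) - g(X,[Z,Y])` at `x` for any fields with `X x = v`, `Y x = w`. -/
def lieTensor (Z : Π x : M, TangentSpace 𝓘(ℝ, E) x)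
    (g : Π x : M, TangentSpace 𝓘(ℝ, E) x →L[ℝ] TangentSpace 𝓘(ℝ, E) x →L[ℝ] ℝ) (x : M) :
    TangentSpace 𝓘(ℝ, E) x →L[ℝ] TangentSpace 𝓘(ℝ, E) x →L[ℝ] ℝ :=
  if h : (∀ Y : Π x : M, TangentSpace 𝓘(ℝ, E) x, MDiffAt (T% Y) x →
        TensorialAt 𝓘(ℝ, E) E (lieTensorAux Z g x · Y) x) ∧
      (∀ X : Π x : M, TangentSpace 𝓘(ℝ, E) x, MDiffAt (T% X) x →
        TensorialAt 𝓘(ℝ, E) E (lieTensorAux Z g x X) x)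
  then TensorialAt.mkHom₂ (lieTensorAux Z g x) x h.1 h.2 else 0

lemma lieTensor_apply {X Y Z : Π x : M, TangentSpace 𝓘(ℝ, E) x}
    {g : Π x : M, TangentSpace 𝓘(ℝ, E) x →L[ℝ] TangentSpace 𝓘(ℝ, E) x →L[ℝ] ℝ}
    (hg : SmoothTwoTensor g) {x : M} (hX : MDiffAt (T% X) x) (hY : MDiffAt (T% Y) x) :
    lieTensor Z g x (X x) (Y x) = mvfderiv 𝓘(ℝ, E) (fun y ↦ g y (X y) (Y y)) x (Z x)
      - g x (mlieBracket 𝓘(ℝ, E) Z X x) (Y x) - g x (X x) (mlieBracket 𝓘(ℝ, E) Z Y x) := by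
  rw [lieTensor, dif_pos ⟨fun Y hY ↦ tensorial_lieTensorAux_left hg hY,
    fun X hX ↦ tensorial_lieTensorAux_right hg hX⟩]
  exact TensorialAt.mkHom₂_apply _ _ hX hY

open Classical in
/-- The exterior derivative `dα` at `x`, as a bilinear form: the value on `(v,w)` is
`X(α(Y)) - Y(α(X)) - α([X,Y])` at `x` for any fields with `X x = v`, `Y x = w`. -/
def extD (α : Π x : M, TangentSpace 𝓘(ℝ, E) x →L[ℝ] ℝ) (x : M) :
    TangentSpace 𝓘(ℝ, E) x →L[ℝ] TangentSpace 𝓘(ℝ, E) x →L[ℝ] ℝ :=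
  if h : (∀ Y : Π x : M, TangentSpace 𝓘(ℝ, E) x, MDiffAt (T% Y) x →
        TensorialAt 𝓘(ℝ, E) E (extDAux α x · Y) x) ∧
      (∀ X : Π x : M, TangentSpace 𝓘(ℝ, E) x, MDiffAt (T% X) x →
        TensorialAt 𝓘(ℝ, E) E (extDAux α x X) x)
  then TensorialAt.mkHom₂ (extDAux α x) x h.1 h.2 else 0

lemma extD_apply {X Y : Π x : M, TangentSpace 𝓘(ℝ, E) x}
    {α : Π x : M, TangentSpace 𝓘(ℝ, E) x →L[ℝ] ℝ} {x : M} (hα : SmoothOneFormAt α x)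
    (hX : MDiffAt (T% X) x) (hY : MDiffAt (T% Y) x) :
    extD α x (X x) (Y x) = mvfderiv 𝓘(ℝ, E) (fun y ↦ α y (Y y)) x (X x)
      - mvfderiv 𝓘(ℝ, E) (fun y ↦ α y (X y)) x (Y x) - α x (mlieBracket 𝓘(ℝ, E) X Y x) := by
  rw [extD, dif_pos ⟨fun Y _ ↦ tensorial_extDAux_left hα, fun X _ ↦ tensorial_extDAux_right hα⟩]
  exact TensorialAt.mkHom₂_apply _ _ hX hY

/-! ### Pseudo-Riemannian metrics and Witt structures -/

variable (E M) in
/-- A pseudo-Riemannian metric: a smooth symmetric non-degenerate `(0,2)`-tensor field. -/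
structure PseudoRiemannianMetric where
  inner : Π x : M, TangentSpace 𝓘(ℝ, E) x →L[ℝ] TangentSpace 𝓘(ℝ, E) x →L[ℝ] ℝ
  smooth : SmoothTwoTensor inner
  symm : ∀ x v w, inner x v w = inner x w v
  nondegenerate : ∀ x v, (∀ w, inner x v w = 0) → v = 0

namespace PseudoRiemannianMetric

variable (g : PseudoRiemannianMetric E M)

/-- The one-form `X♭ = g(X, ·)`. -/
def flat (X : Π x : M, TangentSpace 𝓘(ℝ, E) x) (x : M) : TangentSpace 𝓘(ℝ, E) x →L[ℝ] ℝ :=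
  g.inner x (X x)

/-- `X♭` is smooth wherever `X` is. -/
lemma flat_smooth {X : Π x : M, TangentSpace 𝓘(ℝ, E) x} {x : M} (hX : SmoothFieldAt X x) :
    SmoothOneFormAt (g.flat X) x := by
  have h := g.smooth x
  exact ContMDiffAt.clm_bundle_apply (F₁ := E) (F₂ := E →L[ℝ] ℝ) h hX

lemma nondegenerate_toBilinForm (x : M) : (g.inner x).toBilinForm.Nondegenerate :=
  ⟨fun v hv ↦ g.nondegenerate x v hv,
    fun v hv ↦ g.nondegenerate x v fun w ↦ (g.symm x v w).trans (hv w)⟩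

/-- The inverse musical isomorphism: `α♯` is the vector such that `g(α♯, ·) = α`. -/
def sharp (x : M) (α : TangentSpace 𝓘(ℝ, E) x →L[ℝ] ℝ) : TangentSpace 𝓘(ℝ, E) x :=
  have : FiniteDimensional ℝ (TangentSpace 𝓘(ℝ, E) x) := inferInstanceAs (FiniteDimensional ℝ E)
  ((g.inner x).toBilinForm.toDual (g.nondegenerate_toBilinForm x)).symm
    (α : TangentSpace 𝓘(ℝ, E) x →ₗ[ℝ] ℝ)

lemma inner_sharp (x : M) (α : TangentSpace 𝓘(ℝ, E) x →L[ℝ] ℝ) (v : TangentSpace 𝓘(ℝ, E) x) :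
    g.inner x (g.sharp x α) v = α v := by
  have : FiniteDimensional ℝ (TangentSpace 𝓘(ℝ, E) x) := inferInstanceAs (FiniteDimensional ℝ E)
  exact LinearMap.BilinForm.apply_toDual_symm_apply (hB := g.nondegenerate_toBilinForm x)
    (α : TangentSpace 𝓘(ℝ, E) x →ₗ[ℝ] ℝ) v

end PseudoRiemannianMetric

/-- The index set `{q_1, …, q_r} ∪ {p_1, p_1^*, …, p_s, p_s^*}` of a Witt structure. -/
abbrev Index (r s : ℕ) : Type := Fin r ⊕ (Fin s × Bool)

namespace Index

variable {r s : ℕ}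

/-- The index `q_l`. -/
abbrev q (l : Fin r) : Index r s := Sum.inl l

/-- The index `p_k`. -/
abbrev p (k : Fin s) : Index r s := Sum.inr (k, false)

/-- The index `p_k^*`. -/
abbrev pStar (k : Fin s) : Index r s := Sum.inr (k, true)

/-- The involution `q_l ↦ q_l`, `p_k ↦ p_k^*`, `p_k^* ↦ p_k`. -/
def star : Index r s → Index r s
  | Sum.inl l => Sum.inl l
  | Sum.inr (k, b) => Sum.inr (k, !b)

end Index

/-- A family of subspaces `V x` of the tangent spaces is a smooth subbundle of rank `n` of `TM`:
it has a smooth frame of `n` vector fields near each point. -/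
def IsSmoothSubbundle (V : Π x : M, Submodule ℝ (TangentSpace 𝓘(ℝ, E) x)) (n : ℕ) : Prop :=
  ∀ x₀ : M, ∃ U : Set M, IsOpen U ∧ x₀ ∈ U ∧ ∃ e : Fin n → Π x : M, TangentSpace 𝓘(ℝ, E) x,
    (∀ i, ∀ x ∈ U, SmoothFieldAt (e i) x) ∧
    ∀ x ∈ U, LinearIndependent ℝ (fun i ↦ e i x) ∧ Submodule.span ℝ (Set.range fun i ↦ e i x) = V x

/-- A Witt structure `TM = (⊕_k (V_{p_k} ⊕ V_{p_k^*})) ⊕ (⊕_l V_{q_l})` on a pseudo-Riemannian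
manifold. The sums are orthogonal except between `V_{p_k}` and `V_{p_k^*}`, which are totally
isotropic, of the same rank, and in duality under `g`; the `V_{q_l}` are anisotropic. -/
structure WittStructure (g : PseudoRiemannianMetric E M) (r s : ℕ) where
  V : Index r s → Π x : M, Submodule ℝ (TangentSpace 𝓘(ℝ, E) x)
  rank : Index r s → ℕ
  subbundle : ∀ i, IsSmoothSubbundle (V i) (rank i)
  internal : ∀ x, DirectSum.IsInternal (fun i ↦ V i x)
  orthogonal : ∀ i j, j ≠ i.star → ∀ x, ∀ v ∈ V i x, ∀ w ∈ V j x, g.inner x v w = 0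
  rank_eq : ∀ k, rank (Index.p k) = rank (Index.pStar k)
  dual : ∀ k x, ∀ v ∈ V (Index.p k) x,
    (∀ w ∈ V (Index.pStar k) x, g.inner x v w = 0) → v = 0
  anisotropic : ∀ l x, ∀ v ∈ V (Index.q l) x, g.inner x v v = 0 → v = 0

namespace WittStructure

variable {g : PseudoRiemannianMetric E M} {r s : ℕ} (S : WittStructure g r s)

/-- The linear isomorphism `⊕_i V_{i,x} ≃ T_x M`. -/
def sumEquiv (x : M) : (DirectSum (Index r s) fun i ↦ S.V i x) ≃ₗ[ℝ] TangentSpace 𝓘(ℝ, E) x :=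
  LinearEquiv.ofBijective (DirectSum.coeLinearMap fun i ↦ S.V i x)
    (show Function.Bijective (DirectSum.coeLinearMap fun i ↦ S.V i x) from S.internal x)

/-- The projection `π^i_x` of `T_x M` onto `V_{i,x}` along the other summands. -/
def proj (i : Index r s) (x : M) :
    TangentSpace 𝓘(ℝ, E) x →ₗ[ℝ] TangentSpace 𝓘(ℝ, E) x :=
  (S.V i x).subtype ∘ₗ DirectSum.component ℝ (Index r s) (fun i ↦ S.V i x) i ∘ₗ
    (S.sumEquiv x).symm.toLinearMap

lemma proj_of_mem {i j : Index r s} {x : M} {v : TangentSpace 𝓘(ℝ, E) x} (hv : v ∈ S.V j x) :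
    S.proj i x v = if j = i then v else 0 := by
  have h : (S.sumEquiv x).symm v = DirectSum.lof ℝ _ (fun i ↦ S.V i x) j ⟨v, hv⟩ := by
    rw [LinearEquiv.symm_apply_eq]
    exact (DirectSum.coeLinearMap_lof (fun i ↦ S.V i x) j ⟨v, hv⟩).symm
  simp only [proj, LinearMap.comp_apply, LinearEquiv.coe_coe, h]
  rw [DirectSum.component.of]
  split_ifs with hij
  · subst hij
    rfl
  · rfl

/-- `τ^j(X,Y)` at `x`, for `X` a section of `V_i` and `Y` a section of `V_j`. -/
def tau (i j : Index r s) (X Y : Π x : M, TangentSpace 𝓘(ℝ, E) x) (x : M) :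
    TangentSpace 𝓘(ℝ, E) x :=
  if i = j then 0
  else if i = j.star then
    (1 / 2 : ℝ) • (S.proj j x (g.sharp x (lieForm X (g.flat Y) x + lieForm Y (g.flat X) x))
      - S.proj j x (mlieBracket 𝓘(ℝ, E) X Y x)
      - S.proj j x (g.sharp x (mvfderiv 𝓘(ℝ, E) (fun y ↦ g.inner y (X y) (Y y)) x)))
  else
    (1 / 2 : ℝ) • (S.proj j x (g.sharp x (lieForm X (g.flat Y) x))
      - S.proj j x (mlieBracket 𝓘(ℝ, E) X Y x))

/-- `∇` is the canonical Witt connection: the metric connection which preserves every `V_i` and has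
torsion `T(X,Y) = -[X,Y]_{(V_{i^*} + V_{j^*})^⊥} + τ^j(X,Y) - τ^i(Y,X)` for sections `X` of `V_i`
and `Y` of `V_j`. Since `(V_{i^*} + V_{j^*})^⊥` is the sum of the `V_k` with `k ≠ i` and `k ≠ j`,
the first component is a sum of projections. A connection being a local operator, all the
conditions are imposed on sections smooth at a point. In Mathlib's notation
`∇ Y x v` is `(∇_v Y)(x)`. -/
structure IsCanonicalConnection
    (nabla : CovariantDerivative 𝓘(ℝ, E) E (TangentSpace 𝓘(ℝ, E) : M → Type _)) : Prop where
  smooth : ∀ U : Set M, IsOpen U → ContMDiffCovariantDerivativeOn E ∞ nabla.toFun U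
  metric : ∀ (x : M) (X Y : Π x : M, TangentSpace 𝓘(ℝ, E) x),
    SmoothFieldAt X x → SmoothFieldAt Y x → ∀ v : TangentSpace 𝓘(ℝ, E) x,
      mvfderiv 𝓘(ℝ, E) (fun y ↦ g.inner y (X y) (Y y)) x v
        = g.inner x (nabla X x v) (Y x) + g.inner x (X x) (nabla Y x v)
  preserves : ∀ (i : Index r s) (x : M) (Y : Π x : M, TangentSpace 𝓘(ℝ, E) x),
    SmoothFieldAt Y x → (∀ᶠ y in 𝓝 x, Y y ∈ S.V i y) →
      ∀ v : TangentSpace 𝓘(ℝ, E) x, nabla Y x v ∈ S.V i x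
  torsion_eq : ∀ (i j : Index r s) (x : M) (X Y : Π x : M, TangentSpace 𝓘(ℝ, E) x),
    SmoothFieldAt X x → SmoothFieldAt Y x →
    (∀ᶠ y in 𝓝 x, X y ∈ S.V i y) → (∀ᶠ y in 𝓝 x, Y y ∈ S.V j y) →
      nabla.torsion x (X x) (Y x)
        = - (∑ k with k ≠ i ∧ k ≠ j, S.proj k x (mlieBracket 𝓘(ℝ, E) X Y x))
          + S.tau i j X Y x - S.tau j i Y X x

end WittStructure

/-! ### Curves and variations. Curves on `[0,1]` are given by functions on `ℝ`, of which only the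
restriction to `[0,1]` is used. -/

/-- The velocity of a curve `c : [0,1] → M`. -/
def velocity (c : ℝ → M) (t : ℝ) : TangentSpace 𝓘(ℝ, E) (c t) :=
  mfderivWithin 𝓘(ℝ, ℝ) 𝓘(ℝ, E) c (Icc 0 1) t (1 : ℝ)

/-- The covariant derivative `∇_ċ V` of a vector field `V` along the curve `c : [0,1] → M`. With
`V = ∑ V^i e_i(c)` in the coordinate frame `e_i` of the chart at `c t`, it is
`∑ (dV^i/dt) e_i + V^i ∇_ċ e_i`; here `extend E (V t)` is the local vector field
`∑ V^i(t) e_i` with constant coefficients. -/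
def covDerivAlong (nabla : CovariantDerivative 𝓘(ℝ, E) E (TangentSpace 𝓘(ℝ, E) : M → Type _))
    (c : ℝ → M) (V : Π t : ℝ, TangentSpace 𝓘(ℝ, E) (c t)) (t : ℝ) : TangentSpace 𝓘(ℝ, E) (c t) :=
  (trivializationAt E (TangentSpace 𝓘(ℝ, E)) (c t)).symm (c t)
      (derivWithin (fun u ↦ ((trivializationAt E (TangentSpace 𝓘(ℝ, E)) (c t))
        (⟨c u, V u⟩ : TangentBundle 𝓘(ℝ, E) M)).2) (Icc 0 1) t)
    + nabla (extend E (V t)) (c t) (velocity c t)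

/-- A smooth curve `c : [0,1] → M` that is tangent to the distribution `D`. -/
def IsHorizontalCurve (D : Π x : M, Submodule ℝ (TangentSpace 𝓘(ℝ, E) x)) (c : ℝ → M) : Prop :=
  ContMDiffOn 𝓘(ℝ, ℝ) 𝓘(ℝ, E) ∞ c (Icc 0 1) ∧ ∀ t ∈ Icc (0 : ℝ) 1, velocity c t ∈ D (c t)

variable (E) in
/-- `F : ]-ε,ε[ × [0,1] → M` is a variation with fixed endpoints of the curve `F 0`. -/
def IsVariation (ε : ℝ) (F : ℝ → ℝ → M) : Prop :=
  0 < ε ∧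
  ContMDiffOn 𝓘(ℝ, ℝ × ℝ) 𝓘(ℝ, E) ∞ (fun z : ℝ × ℝ ↦ F z.1 z.2) (Ioo (-ε) ε ×ˢ Icc 0 1) ∧
  ∀ u ∈ Ioo (-ε) ε, F u 0 = F 0 0 ∧ F u 1 = F 0 1

/-- The variation field `w_{(0,t)} = ∂F/∂s (0,t)`. -/
def variationField (F : ℝ → ℝ → M) (t : ℝ) : TangentSpace 𝓘(ℝ, E) (F 0 t) :=
  mfderiv 𝓘(ℝ, ℝ) 𝓘(ℝ, E) (fun u ↦ F u t) 0 (1 : ℝ)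

/-- The one-form `α^λ = λ₁ σ + λ₂ σ^*`. -/
def alphaForm (lam₁ lam₂ : M → ℝ) (sigma sigmaStar : Π x : M, TangentSpace 𝓘(ℝ, E) x →L[ℝ] ℝ)
    (x : M) : TangentSpace 𝓘(ℝ, E) x →L[ℝ] ℝ :=
  lam₁ x • sigma x + lam₂ x • sigmaStar x

/-- The energy `E(c) = 1/2 ∫ g(ċ,ċ) dt`. -/
def energy (g : PseudoRiemannianMetric E M) (c : ℝ → M) : ℝ :=
  (1 / 2 : ℝ) * ∫ t in (0 : ℝ)..1, g.inner (c t) (velocity c t) (velocity c t)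

/-- The functional `E(c) - ∫ α(ċ) dt`; it is `E^λ` for `α = α^λ`. -/
def energyWithForm (g : PseudoRiemannianMetric E M)
    (α : Π x : M, TangentSpace 𝓘(ℝ, E) x →L[ℝ] ℝ) (c : ℝ → M) : ℝ :=
  energy g c - ∫ t in (0 : ℝ)..1, α (c t) (velocity c t)

end Witt

end

noncomputable section

set_option synthInstance.maxHeartbeats 200000
set_option linter.unusedSectionVars false

namespace Witt

/-! ### Calculus in a normed space: the Lagrangian and its boundary term. -/

section Calculus

variable {E H : Type*} [NormedAddCommGroup E] [NormedSpace ℝ E]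
  [NormedAddCommGroup H] [NormedSpace ℝ H]

/-! Put `v = ċ`, `L = ½ g(ċ, ċ) - α(ċ)` and `b = g(ċ, w) - α(w)`. In `∂ₛL - ∂ₜb` the mixed second
derivatives of the variation cancel. What remains at a point depends only on `v`, `w`, the
coordinate acceleration `a`, and the first derivatives of `g` and `α`: `½ Dg(w)(v,v) - Dg(v)(v,w) -
g(a,w) + Dα(v)w - Dα(w)v` (`fderiv_lagrangian_sub`). Since `w` vanishes at the fixed endpoints, so
does `b`, and the derivative of `E^λ` is the integral of this expression
(`hasDerivAt_integral_of_boundary`).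

The rest is pointwise algebra (`variation_integrand_eq`), after splitting `w = w_H + σ(w) ξ + σ*(w)
ξ*`. In the direction `w_H`, the torsion of two horizontal vectors has no horizontal component, so
the metric connection behaves there like a Levi-Civita connection and the metric terms give `-g(∇_ċ
ċ, w_H)`. In the direction `ξ`, differentiating `σ*(ċ) = 0` along the curve eliminates `g(a, ξ)`,
and the metric terms become `½ (L_ξ g)(v,v)`. As `σ(ξ)` and `σ*(ξ)` are constant, `dσ(v, ξ) = -(L_ξ
σ)(v)`, and likewise for `σ*`. The direction `ξ*` is analogous. The derivatives of `λ` along `w`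
drop out because `σ` and `σ*` annihilate `v`.

All local computations take place in the preferred chart at the point considered. The derivative of
that chart at its centre is the identity, and the fields `extend E v` have constant coefficients in
it. -/

lemma differentiableAt_clm_of_apply {V : Type*} [NormedAddCommGroup V] [NormedSpace ℝ V]
    [FiniteDimensional ℝ E] {A : H → E →L[ℝ] V} {z : H}
    (h : ∀ v, DifferentiableAt ℝ (fun y ↦ A y v) z) : DifferentiableAt ℝ A z := by
  let e₁ : E ≃L[ℝ] Fin (Module.finrank ℝ E) → ℝ := ContinuousLinearEquiv.ofFinrankEq (by simp)
  -- In a basis, a linear map is the finite tuple of its values on the basis vectors, so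
  -- differentiability can be tested entry by entry.
  let e₂ := (e₁.arrowCongr (1 : V ≃L[ℝ] V)).trans
    (ContinuousLinearEquiv.piRing (Fin (Module.finrank ℝ E)))
  have h2 : DifferentiableAt ℝ (fun y ↦ e₂ (A y)) z := differentiableAt_pi.2 fun i ↦ h _
  exact (e₂.symm.differentiableAt.comp z h2).congr_of_eventuallyEq (.of_forall fun y ↦ by simp)

/-- Chain and product rule together; the existential hides the composite operator, of which only the
values are needed later. -/
lemma hasFDerivAt_covector_comp {A : E → E →L[ℝ] ℝ} {f u : H → E}
    {f' u' : H →L[ℝ] E} {z : H} (hA : DifferentiableAt ℝ A (f z)) (hf : HasFDerivAt f f' z)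
    (hu : HasFDerivAt u u' z) :
    ∃ T : H →L[ℝ] ℝ, HasFDerivAt (fun y ↦ A (f y) (u y)) T z ∧
      ∀ h, T h = fderiv ℝ A (f z) (f' h) (u z) + A (f z) (u' h) := by
  have hAf : HasFDerivAt (fun y ↦ A (f y)) ((fderiv ℝ A (f z)).comp f') z :=
    hA.hasFDerivAt.comp (𝕜 := ℝ) (G := E →L[ℝ] ℝ) z hf
  refine ⟨_, hAf.clm_apply hu, fun h ↦ ?_⟩
  simp [add_comm]

lemma hasFDerivAt_bilin_comp {G : E → E →L[ℝ] E →L[ℝ] ℝ} {f u v : H → E}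
    {f' u' v' : H →L[ℝ] E} {z : H} (hG : DifferentiableAt ℝ G (f z)) (hf : HasFDerivAt f f' z)
    (hu : HasFDerivAt u u' z) (hv : HasFDerivAt v v' z) :
    ∃ T : H →L[ℝ] ℝ, HasFDerivAt (fun y ↦ G (f y) (u y) (v y)) T z ∧
      ∀ h, T h = fderiv ℝ G (f z) (f' h) (u z) (v z) + G (f z) (u' h) (v z)
        + G (f z) (u z) (v' h) := by
  have hGf : HasFDerivAt (fun y ↦ G (f y)) ((fderiv ℝ G (f z)).comp f') z :=
    hG.hasFDerivAt.comp (𝕜 := ℝ) (G := E →L[ℝ] E →L[ℝ] ℝ) z hf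
  have hGu : HasFDerivAt (fun y ↦ G (f y) (u y))
      ((G (f z)).comp u' + ((fderiv ℝ G (f z)).comp f').flip (u z)) z :=
    HasFDerivAt.clm_apply (𝕜 := ℝ) (H := E →L[ℝ] ℝ) hGf hu
  refine ⟨_, hGu.clm_apply hv, fun h ↦ ?_⟩
  simp
  ring

/-- The derivative of the integrand of `∫ ½ g(ċ, ċ) - α(ċ)` along a variation, up to the
`t`-derivative of `g(ċ, w) - α(w)`, in coordinates. -/
lemma fderiv_lagrangian_sub_fderiv_boundary {G : E → E →L[ℝ] E →L[ℝ] ℝ} {A : E → E →L[ℝ] ℝ}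
    {f : ℝ × ℝ → E} {z : ℝ × ℝ} (hf : ContDiffAt ℝ 2 f z)
    (hG : DifferentiableAt ℝ G (f z)) (hA : DifferentiableAt ℝ A (f z))
    (hsymm : ∀ x y, G (f z) x y = G (f z) y x)
    {v w : E} (hv : fderiv ℝ f z (0, 1) = v) (hw : fderiv ℝ f z (1, 0) = w) :
    fderiv ℝ (fun y ↦ (1 / 2 : ℝ) * G (f y) (fderiv ℝ f y (0, 1)) (fderiv ℝ f y (0, 1))
        - A (f y) (fderiv ℝ f y (0, 1))) z (1, 0)
      - fderiv ℝ (fun y ↦ G (f y) (fderiv ℝ f y (0, 1)) (fderiv ℝ f y (1, 0))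
        - A (f y) (fderiv ℝ f y (1, 0))) z (0, 1)
      = 1 / 2 * fderiv ℝ G (f z) w v v - fderiv ℝ G (f z) v v w
        - G (f z) (fderiv ℝ (fderiv ℝ f) z (0, 1) (0, 1)) w
        + fderiv ℝ A (f z) v w - fderiv ℝ A (f z) w v := by
  subst hv hw
  have hf1 : HasFDerivAt f (fderiv ℝ f z) z := (hf.differentiableAt (by simp)).hasFDerivAt
  have hf2 : HasFDerivAt (fderiv ℝ f) (fderiv ℝ (fderiv ℝ f) z) z :=
    ((hf.fderiv_right (m := 1) (by norm_num)).differentiableAt (by simp)).hasFDerivAt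
  have hft : ∀ d : ℝ × ℝ, HasFDerivAt (fun y ↦ fderiv ℝ f y d)
      ((fderiv ℝ (fderiv ℝ f) z).flip d) z := fun d ↦ by
    simpa using hf2.clm_apply (hasFDerivAt_const d z)
  -- Symmetry of second derivatives gives `∂ₛċ = ∂ₜw`. This is the cancellation for which the
  -- boundary term is chosen.
  have hsnd : fderiv ℝ (fderiv ℝ f) z (1, 0) (0, 1) = fderiv ℝ (fderiv ℝ f) z (0, 1) (1, 0) :=
    (hf.isSymmSndFDerivAt (by simp)) _ _
  obtain ⟨T₁, hT₁, hT₁'⟩ := hasFDerivAt_bilin_comp hG hf1 (hft (0, 1)) (hft (0, 1))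
  obtain ⟨T₂, hT₂, hT₂'⟩ := hasFDerivAt_bilin_comp hG hf1 (hft (0, 1)) (hft (1, 0))
  obtain ⟨T₃, hT₃, hT₃'⟩ := hasFDerivAt_covector_comp hA hf1 (hft (0, 1))
  obtain ⟨T₄, hT₄, hT₄'⟩ := hasFDerivAt_covector_comp hA hf1 (hft (1, 0))
  have h1 := ((hT₁.const_mul (1 / 2 : ℝ)).sub hT₃).fderiv
  have h2 := (hT₂.sub hT₄).fderiv
  have e1 : fderiv ℝ (fun y ↦ (1 / 2 : ℝ) * G (f y) (fderiv ℝ f y (0, 1)) (fderiv ℝ f y (0, 1))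
        - A (f y) (fderiv ℝ f y (0, 1))) z (1, 0) = 1 / 2 * T₁ (1, 0) - T₃ (1, 0) := by
    erw [h1]; simp
  have e2 : fderiv ℝ (fun y ↦ G (f y) (fderiv ℝ f y (0, 1)) (fderiv ℝ f y (1, 0))
        - A (f y) (fderiv ℝ f y (1, 0))) z (0, 1) = T₂ (0, 1) - T₄ (0, 1) := by
    erw [h2]; simp
  rw [e1, e2, hT₁', hT₂', hT₃', hT₄']
  simp only [ContinuousLinearMap.flip_apply, hsnd]
  -- By symmetry of `G` the two halves of `½ ∂ₛ G(ċ, ċ)` that contain `∂ₛċ` add up to the single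
  -- term `G(ċ, ∂ₜw)` coming from the boundary part.
  rw [hsymm (fderiv ℝ f z (0, 1)) (fderiv ℝ (fderiv ℝ f) z (0, 1) (1, 0))]
  ring

end Calculus

/-! ### Differentiation under the integral and integration by parts on a strip. -/

section Integral

open MeasureTheory

lemma uniqueDiffOn_Ioo_prod_Icc {ε : ℝ} : UniqueDiffOn ℝ (Ioo (-ε) ε ×ˢ Icc (0 : ℝ) 1) :=
  isOpen_Ioo.uniqueDiffOn.prod (uniqueDiffOn_Icc zero_lt_one)

lemma continuousOn_fderivWithin_slice {ε : ℝ} (hε : 0 < ε) {e : ℝ × ℝ → ℝ}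
    (he : ContDiffOn ℝ 1 e (Ioo (-ε) ε ×ˢ Icc 0 1)) (d : ℝ × ℝ) :
    ContinuousOn (fun t ↦ fderivWithin ℝ e (Ioo (-ε) ε ×ˢ Icc 0 1) (0, t) d) (Icc 0 1) := by
  have h := (he.continuousOn_fderivWithin uniqueDiffOn_Ioo_prod_Icc le_rfl).clm_apply
    (continuousOn_const (c := d))
  exact h.comp (f := fun t : ℝ ↦ ((0 : ℝ), t)) (by fun_prop) fun t ht ↦ ⟨by simp [hε], ht⟩

lemma hasDerivAt_integral_slice {ε : ℝ} (hε : 0 < ε) {e : ℝ × ℝ → ℝ}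
    (he : ContDiffOn ℝ 1 e (Ioo (-ε) ε ×ˢ Icc 0 1)) :
    HasDerivAt (fun s ↦ ∫ t in (0 : ℝ)..1, e (s, t))
      (∫ t in (0 : ℝ)..1, fderivWithin ℝ e (Ioo (-ε) ε ×ˢ Icc 0 1) (0, t) (1, 0)) 0 := by
  set Ω := Ioo (-ε) ε ×ˢ Icc (0 : ℝ) 1 with hΩ
  have hslice : ∀ s ∈ Ioo (-ε) ε, ContinuousOn (fun t ↦ e (s, t)) (Icc 0 1) := fun s hs ↦
    he.continuousOn.comp (f := fun t : ℝ ↦ (s, t)) (by fun_prop) fun t ht ↦ ⟨hs, ht⟩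
  have hd : ContinuousOn (fun z ↦ fderivWithin ℝ e Ω z (1, 0)) Ω :=
    (he.continuousOn_fderivWithin uniqueDiffOn_Ioo_prod_Icc le_rfl).clm_apply continuousOn_const
  -- Halving the width gives a compact strip inside `Ω`, on which the continuous `s`-derivative is
  -- bounded; the bound is the dominating constant.
  have hK : IsCompact (Icc (-(ε / 2)) (ε / 2) ×ˢ Icc (0 : ℝ) 1) := isCompact_Icc.prod isCompact_Icc
  have hKΩ : Icc (-(ε / 2)) (ε / 2) ×ˢ Icc (0 : ℝ) 1 ⊆ Ω :=
    prod_mono (fun s hs ↦ ⟨by linarith [hs.1], by linarith [hs.2]⟩) le_rfl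
  obtain ⟨C, hC⟩ := hK.exists_bound_of_continuousOn (hd.mono hKΩ)
  have hI : uIoc (0 : ℝ) 1 ⊆ Icc 0 1 := by
    rw [uIoc_of_le zero_le_one]; exact Ioc_subset_Icc_self
  refine (intervalIntegral.hasDerivAt_integral_of_dominated_loc_of_deriv_le
    (F := fun s t ↦ e (s, t)) (F' := fun s t ↦ fderivWithin ℝ e Ω (s, t) (1, 0))
    (bound := fun _ ↦ C) (s := Ioo (-(ε / 2)) (ε / 2)) (Ioo_mem_nhds (by linarith) (by linarith))
    ?_ ?_ ?_ ?_ (by simp) ?_).2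
  · filter_upwards [Ioo_mem_nhds (neg_lt_zero.2 hε) hε] with s hs
    exact ((hslice s hs).mono hI).aestronglyMeasurable measurableSet_uIoc
  · apply ContinuousOn.intervalIntegrable
    rw [uIcc_of_le zero_le_one]
    exact hslice 0 (by simp [hε])
  · exact ((continuousOn_fderivWithin_slice hε he _).mono hI).aestronglyMeasurable
      measurableSet_uIoc
  · exact Filter.Eventually.of_forall fun t ht s hs ↦ hC (s, t) ⟨Ioo_subset_Icc_self hs, hI ht⟩
  · refine Filter.Eventually.of_forall fun t ht s hs ↦ ?_
    have hs' : s ∈ Ioo (-ε) ε := ⟨by linarith [hs.1], by linarith [hs.2]⟩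
    have h1 : HasFDerivWithinAt e (fderivWithin ℝ e Ω (s, t)) Ω (s, t) :=
      (he.differentiableOn (by simp) (s, t) ⟨hs', hI ht⟩).hasFDerivWithinAt
    -- The slice in the `s`-direction is open, so the derivative within it is a full derivative even
    -- where `(s, t)` lies on the boundary of the strip.
    have h2 : HasDerivWithinAt (fun s : ℝ ↦ (s, t)) ((1 : ℝ), (0 : ℝ)) (Ioo (-ε) ε) s :=
      ((hasDerivAt_id s).prodMk (hasDerivAt_const s t)).hasDerivWithinAt
    exact (HasFDerivWithinAt.comp_hasDerivWithinAt (f := fun s : ℝ ↦ (s, t)) (l := e) s h1 h2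
      (fun u hu ↦ show u ∈ Ioo (-ε) ε ∧ t ∈ Icc (0 : ℝ) 1 from ⟨hu, hI ht⟩)).hasDerivAt
      (Ioo_mem_nhds hs'.1 hs'.2)

lemma integral_fderivWithin_slice {ε : ℝ} (hε : 0 < ε) {b : ℝ × ℝ → ℝ}
    (hb : ContDiffOn ℝ 1 b (Ioo (-ε) ε ×ˢ Icc 0 1)) :
    ∫ t in (0 : ℝ)..1, fderivWithin ℝ b (Ioo (-ε) ε ×ˢ Icc 0 1) (0, t) (0, 1)
      = b (0, 1) - b (0, 0) := by
  have h0 : ∀ t ∈ Icc (0 : ℝ) 1, HasDerivWithinAt (fun t ↦ b (0, t))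
      (fderivWithin ℝ b (Ioo (-ε) ε ×ˢ Icc 0 1) (0, t) (0, 1)) (Icc 0 1) t := fun t ht ↦ by
    have h1 := (hb.differentiableOn (by simp) (0, t) ⟨by simp [hε], ht⟩).hasFDerivWithinAt
    have h2 : HasDerivWithinAt (fun t : ℝ ↦ ((0 : ℝ), t)) ((0 : ℝ), (1 : ℝ)) (Icc 0 1) t :=
      ((hasDerivAt_const t (0 : ℝ)).prodMk (hasDerivAt_id t)).hasDerivWithinAt
    exact HasFDerivWithinAt.comp_hasDerivWithinAt (f := fun t : ℝ ↦ ((0 : ℝ), t)) (l := b) t h1 h2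
      (fun u hu ↦ show (0 : ℝ) ∈ Ioo (-ε) ε ∧ u ∈ Icc (0 : ℝ) 1 from ⟨by simp [hε], hu⟩)
  refine intervalIntegral.integral_eq_sub_of_hasDerivAt_of_le zero_le_one
    (fun t ht ↦ (h0 t ht).continuousWithinAt)
    (fun t ht ↦ (h0 t (Ioo_subset_Icc_self ht)).hasDerivAt (Icc_mem_nhds ht.1 ht.2)) ?_
  apply ContinuousOn.intervalIntegrable
  rw [uIcc_of_le zero_le_one]
  exact continuousOn_fderivWithin_slice hε hb _

/-- Differentiation of `∫ e(s, t) dt` at `s = 0`, after an integration by parts with boundary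
term `b`. -/
lemma hasDerivAt_integral_of_boundary {ε : ℝ} (hε : 0 < ε) {e b : ℝ × ℝ → ℝ} {φ : ℝ → ℝ}
    (he : ContDiffOn ℝ 1 e (Ioo (-ε) ε ×ˢ Icc 0 1))
    (hb : ContDiffOn ℝ 1 b (Ioo (-ε) ε ×ˢ Icc 0 1)) (hb0 : b (0, 0) = 0) (hb1 : b (0, 1) = 0)
    (hφ : ∀ t ∈ Ioo (0 : ℝ) 1, fderiv ℝ e (0, t) (1, 0) - fderiv ℝ b (0, t) (0, 1) = φ t) :
    IntervalIntegrable φ volume 0 1 ∧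
      HasDerivAt (fun s ↦ ∫ t in (0 : ℝ)..1, e (s, t)) (∫ t in (0 : ℝ)..1, φ t) 0 := by
  set Ω := Ioo (-ε) ε ×ˢ Icc (0 : ℝ) 1 with hΩ
  have hi : ∀ {c : ℝ × ℝ → ℝ}, ContDiffOn ℝ 1 c Ω → ∀ d : ℝ × ℝ,
      IntervalIntegrable (fun t ↦ fderivWithin ℝ c Ω (0, t) d) volume 0 1 := fun hc d ↦ by
    apply ContinuousOn.intervalIntegrable
    rw [uIcc_of_le zero_le_one]
    exact continuousOn_fderivWithin_slice hε hc _
  -- `uIoc 0 1` already omits `0`; discarding the null set `{1}` leaves interior points, where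
  -- derivatives within `Ω` are ordinary ones and `hφ` applies.
  have hne : ∀ᵐ t : ℝ, t ≠ 1 := by simp [ae_iff]
  have hae : ∀ᵐ t : ℝ, t ∈ uIoc (0 : ℝ) 1 →
      fderivWithin ℝ e Ω (0, t) (1, 0) - fderivWithin ℝ b Ω (0, t) (0, 1) = φ t := by
    filter_upwards [hne] with t h1 ht
    rw [uIoc_of_le zero_le_one] at ht
    have ht' : t ∈ Ioo (0 : ℝ) 1 := ⟨ht.1, lt_of_le_of_ne ht.2 h1⟩
    have hΩt : Ω ∈ 𝓝 ((0 : ℝ), t) :=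
      prod_mem_nhds (Ioo_mem_nhds (neg_lt_zero.2 hε) hε) (Icc_mem_nhds ht'.1 ht'.2)
    rw [fderivWithin_of_mem_nhds hΩt, fderivWithin_of_mem_nhds hΩt]
    exact hφ t ht'
  refine ⟨((hi he _).sub (hi hb _)).congr_ae ((ae_restrict_iff' measurableSet_uIoc).2 hae), ?_⟩
  rw [← intervalIntegral.integral_congr_ae hae,
    intervalIntegral.integral_sub (hi he _) (hi hb _), integral_fderivWithin_slice hε hb, hb0, hb1,
    sub_zero, sub_zero]
  exact hasDerivAt_integral_slice hε he

end Integral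

/-! ### Fields, forms, tensors and their Lie derivatives in a chart. -/

section Coordinates

variable {E : Type*} [NormedAddCommGroup E] [NormedSpace ℝ E] [FiniteDimensional ℝ E]
  {M : Type*} [TopologicalSpace M] [ChartedSpace E M] [IsManifold 𝓘(ℝ, E) ∞ M]

/-- The coordinate expression of a vector field in the chart at `x₀`. -/
def coordVec (x₀ : M) (X : Π x : M, TangentSpace 𝓘(ℝ, E) x) (y : E) : E :=
  mfderiv 𝓘(ℝ, E) 𝓘(ℝ, E) (extChartAt 𝓘(ℝ, E) x₀) ((extChartAt 𝓘(ℝ, E) x₀).symm y)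
    (X ((extChartAt 𝓘(ℝ, E) x₀).symm y))

/-- The coordinate expression of a one-form in the chart at `x₀`. -/
def coordForm (x₀ : M) (α : Π x : M, TangentSpace 𝓘(ℝ, E) x →L[ℝ] ℝ) (y : E) : E →L[ℝ] ℝ :=
  (α ((extChartAt 𝓘(ℝ, E) x₀).symm y)).comp
    (mfderivWithin 𝓘(ℝ, E) 𝓘(ℝ, E) (extChartAt 𝓘(ℝ, E) x₀).symm (range 𝓘(ℝ, E)) y)

/-- The coordinate expression of a `(0,2)`-tensor in the chart at `x₀`. -/
def coordBilin (x₀ : M)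
    (g : Π x : M, TangentSpace 𝓘(ℝ, E) x →L[ℝ] TangentSpace 𝓘(ℝ, E) x →L[ℝ] ℝ) (y : E) :
    E →L[ℝ] E →L[ℝ] ℝ :=
  ContinuousLinearMap.bilinearComp (E := E) (F := E) (E' := E) (F' := E)
    (g ((extChartAt 𝓘(ℝ, E) x₀).symm y))
    (mfderivWithin 𝓘(ℝ, E) 𝓘(ℝ, E) (extChartAt 𝓘(ℝ, E) x₀).symm (range 𝓘(ℝ, E)) y)
    (mfderivWithin 𝓘(ℝ, E) 𝓘(ℝ, E) (extChartAt 𝓘(ℝ, E) x₀).symm (range 𝓘(ℝ, E)) y)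

variable {x₀ p : M} {X Y Z : Π x : M, TangentSpace 𝓘(ℝ, E) x}
  {α : Π x : M, TangentSpace 𝓘(ℝ, E) x →L[ℝ] ℝ}
  {g : Π x : M, TangentSpace 𝓘(ℝ, E) x →L[ℝ] TangentSpace 𝓘(ℝ, E) x →L[ℝ] ℝ}

lemma coordVec_apply (hp : p ∈ (extChartAt 𝓘(ℝ, E) x₀).source) :
    coordVec x₀ X (extChartAt 𝓘(ℝ, E) x₀ p)
      = mfderiv 𝓘(ℝ, E) 𝓘(ℝ, E) (extChartAt 𝓘(ℝ, E) x₀) p (X p) := by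
  rw [coordVec, (extChartAt 𝓘(ℝ, E) x₀).left_inv hp]

lemma mfderivWithin_symm_mfderiv_apply (hp : p ∈ (extChartAt 𝓘(ℝ, E) x₀).source)
    (v : TangentSpace 𝓘(ℝ, E) p) :
    (mfderivWithin 𝓘(ℝ, E) 𝓘(ℝ, E) (extChartAt 𝓘(ℝ, E) x₀).symm (range 𝓘(ℝ, E))
      (extChartAt 𝓘(ℝ, E) x₀ p) : E →L[ℝ] E)
      ((mfderiv 𝓘(ℝ, E) 𝓘(ℝ, E) (extChartAt 𝓘(ℝ, E) x₀) p : E →L[ℝ] E) v) = v :=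
  congrArg (fun T : E →L[ℝ] E ↦ T v) (mfderivWithin_extChartAt_symm_comp_mfderiv_extChartAt' hp)

lemma coordForm_apply (hp : p ∈ (extChartAt 𝓘(ℝ, E) x₀).source) (v : TangentSpace 𝓘(ℝ, E) p) :
    coordForm x₀ α (extChartAt 𝓘(ℝ, E) x₀ p)
      (mfderiv 𝓘(ℝ, E) 𝓘(ℝ, E) (extChartAt 𝓘(ℝ, E) x₀) p v) = α p v := by
  have h : (α ((extChartAt 𝓘(ℝ, E) x₀).symm (extChartAt 𝓘(ℝ, E) x₀ p)) : E →L[ℝ] ℝ) = α p := by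
    rw [(extChartAt 𝓘(ℝ, E) x₀).left_inv hp]
  have h2 := mfderivWithin_symm_mfderiv_apply hp v
  exact (congrArg (fun T : E →L[ℝ] ℝ ↦ T _) h).trans (congrArg (α p : E →L[ℝ] ℝ) h2)

lemma coordBilin_apply (hp : p ∈ (extChartAt 𝓘(ℝ, E) x₀).source) (v w : TangentSpace 𝓘(ℝ, E) p) :
    coordBilin x₀ g (extChartAt 𝓘(ℝ, E) x₀ p)
      (mfderiv 𝓘(ℝ, E) 𝓘(ℝ, E) (extChartAt 𝓘(ℝ, E) x₀) p v)
      (mfderiv 𝓘(ℝ, E) 𝓘(ℝ, E) (extChartAt 𝓘(ℝ, E) x₀) p w) = g p v w := by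
  have h : (g ((extChartAt 𝓘(ℝ, E) x₀).symm (extChartAt 𝓘(ℝ, E) x₀ p)) : E →L[ℝ] E →L[ℝ] ℝ)
      = g p := by
    rw [(extChartAt 𝓘(ℝ, E) x₀).left_inv hp]
  have h2 := mfderivWithin_symm_mfderiv_apply hp v
  have h3 := mfderivWithin_symm_mfderiv_apply hp w
  exact (congrArg (fun T : E →L[ℝ] E →L[ℝ] ℝ ↦ T _ _) h).trans
    (congrArg₂ (fun a b ↦ (g p : E →L[ℝ] E →L[ℝ] ℝ) a b) h2 h3)

/-- The preferred chart at `x₀` has the identity as its derivative at `x₀`, so there coordinates and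
tangent vectors coincide. This lets coordinate identities be stated directly in the tangent space.
-/
lemma coordVec_self : coordVec x₀ X (extChartAt 𝓘(ℝ, E) x₀ x₀) = X x₀ := by
  rw [coordVec_apply (mem_extChartAt_source x₀), mfderiv_extChartAt_self]
  rfl

lemma coordForm_self : coordForm x₀ α (extChartAt 𝓘(ℝ, E) x₀ x₀) = α x₀ := by
  ext v
  have h := coordForm_apply (α := α) (mem_extChartAt_source (I := 𝓘(ℝ, E)) x₀) v
  rwa [mfderiv_extChartAt_self] at h

lemma coordBilin_self : coordBilin x₀ g (extChartAt 𝓘(ℝ, E) x₀ x₀) = g x₀ := by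
  ext v w
  have h := coordBilin_apply (g := g) (mem_extChartAt_source (I := 𝓘(ℝ, E)) x₀) v w
  rwa [mfderiv_extChartAt_self] at h

lemma coordForm_coordVec {y : E} (hy : y ∈ (extChartAt 𝓘(ℝ, E) x₀).target) :
    coordForm x₀ α y (coordVec x₀ X y)
      = α ((extChartAt 𝓘(ℝ, E) x₀).symm y) (X ((extChartAt 𝓘(ℝ, E) x₀).symm y)) := by
  have h := coordForm_apply (α := α) ((extChartAt 𝓘(ℝ, E) x₀).map_target hy)
    (X ((extChartAt 𝓘(ℝ, E) x₀).symm y))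
  rwa [(extChartAt 𝓘(ℝ, E) x₀).right_inv hy] at h

lemma coordBilin_coordVec {y : E} (hy : y ∈ (extChartAt 𝓘(ℝ, E) x₀).target) :
    coordBilin x₀ g y (coordVec x₀ X y) (coordVec x₀ Y y)
      = g ((extChartAt 𝓘(ℝ, E) x₀).symm y) (X ((extChartAt 𝓘(ℝ, E) x₀).symm y))
        (Y ((extChartAt 𝓘(ℝ, E) x₀).symm y)) := by
  have h := coordBilin_apply (g := g) ((extChartAt 𝓘(ℝ, E) x₀).map_target hy)
    (X ((extChartAt 𝓘(ℝ, E) x₀).symm y)) (Y ((extChartAt 𝓘(ℝ, E) x₀).symm y))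
  rwa [(extChartAt 𝓘(ℝ, E) x₀).right_inv hy] at h

lemma target_mem_nhds : (extChartAt 𝓘(ℝ, E) x₀).target ∈ 𝓝 (extChartAt 𝓘(ℝ, E) x₀ x₀) :=
  extChartAt_target_mem_nhds x₀

/-- Links the bundle trivialization, through which `extend` and `covDerivAlong` are defined, to the
derivative of the chart used in `coordVec`. -/
lemma trivializationAt_apply_snd (hp : p ∈ (extChartAt 𝓘(ℝ, E) x₀).source)
    (v : TangentSpace 𝓘(ℝ, E) p) :
    (trivializationAt E (TangentSpace 𝓘(ℝ, E)) x₀ ⟨p, v⟩).2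
      = mfderiv 𝓘(ℝ, E) 𝓘(ℝ, E) (extChartAt 𝓘(ℝ, E) x₀) p v := by
  have hp' : p ∈ (chartAt E x₀).source := by rwa [extChartAt_source] at hp
  have hb : p ∈ (trivializationAt E (TangentSpace 𝓘(ℝ, E)) x₀).baseSet := by simpa using hp'
  rw [← TangentBundle.continuousLinearMapAt_trivializationAt (I := 𝓘(ℝ, E)) hp']
  exact ((trivializationAt E (TangentSpace 𝓘(ℝ, E)) x₀).continuousLinearMapAt_apply_of_mem
    ℝ hb v).symm

lemma trivializationAt_self_apply_snd (v : TangentSpace 𝓘(ℝ, E) x₀) :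
    (trivializationAt E (TangentSpace 𝓘(ℝ, E)) x₀ ⟨x₀, v⟩).2 = v := by
  rw [trivializationAt_apply_snd (mem_extChartAt_source x₀), mfderiv_extChartAt_self]
  rfl

lemma trivializationAt_self_symm (v : TangentSpace 𝓘(ℝ, E) x₀) :
    (trivializationAt E (TangentSpace 𝓘(ℝ, E)) x₀).symm x₀ v = v := by
  have h := extend_apply_self (F := E) v
  rwa [extend, trivializationAt_self_apply_snd] at h

/-- Constancy holds on the whole chart domain, not only at `x₀`. Hence `extend E v` has zero
coordinate derivative, and evaluating a tensor on such fields reads off its components. -/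
lemma coordVec_extend_apply (v : TangentSpace 𝓘(ℝ, E) x₀) {y : E}
    (hy : y ∈ (extChartAt 𝓘(ℝ, E) x₀).target) : coordVec x₀ (extend E v) y = v := by
  have hp := (extChartAt 𝓘(ℝ, E) x₀).map_target hy
  have hb : (extChartAt 𝓘(ℝ, E) x₀).symm y
      ∈ (trivializationAt E (TangentSpace 𝓘(ℝ, E)) x₀).baseSet := by simpa using hp
  rw [coordVec, ← trivializationAt_apply_snd hp, extend, trivializationAt_self_apply_snd]
  exact congrArg Prod.snd
    ((trivializationAt E (TangentSpace 𝓘(ℝ, E)) x₀).apply_mk_symm hb (show E from v))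

lemma coordVec_extend (v : TangentSpace 𝓘(ℝ, E) x₀) :
    coordVec x₀ (extend E v) =ᶠ[𝓝 (extChartAt 𝓘(ℝ, E) x₀ x₀)] fun _ ↦ v := by
  filter_upwards [target_mem_nhds] with y hy
  exact coordVec_extend_apply v hy

lemma coordForm_apply_eq (v : E) {y : E} (hy : y ∈ (extChartAt 𝓘(ℝ, E) x₀).target) :
    coordForm x₀ α y v = α ((extChartAt 𝓘(ℝ, E) x₀).symm y)
      (extend E (show TangentSpace 𝓘(ℝ, E) x₀ from v) ((extChartAt 𝓘(ℝ, E) x₀).symm y)) := by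
  rw [← coordForm_coordVec hy, coordVec_extend_apply _ hy]

lemma coordBilin_apply_eq (v w : E) {y : E} (hy : y ∈ (extChartAt 𝓘(ℝ, E) x₀).target) :
    coordBilin x₀ g y v w = g ((extChartAt 𝓘(ℝ, E) x₀).symm y)
      (extend E (show TangentSpace 𝓘(ℝ, E) x₀ from v) ((extChartAt 𝓘(ℝ, E) x₀).symm y))
      (extend E (show TangentSpace 𝓘(ℝ, E) x₀ from w) ((extChartAt 𝓘(ℝ, E) x₀).symm y)) := by
  rw [← coordBilin_coordVec hy, coordVec_extend_apply _ hy, coordVec_extend_apply _ hy]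

lemma differentiableAt_comp_extChartAt_symm {h : M → ℝ}
    (hh : MDifferentiableAt 𝓘(ℝ, E) 𝓘(ℝ, ℝ) h x₀) :
    DifferentiableAt ℝ (fun y ↦ h ((extChartAt 𝓘(ℝ, E) x₀).symm y))
      (extChartAt 𝓘(ℝ, E) x₀ x₀) := by
  have h1 := hh.differentiableWithinAt_writtenInExtChartAt
  rw [modelWithCornersSelf_coe, range_id, differentiableWithinAt_univ] at h1
  exact h1

lemma mvfderiv_apply_eq_fderiv {h : M → ℝ}
    (hh : MDifferentiableAt 𝓘(ℝ, E) 𝓘(ℝ, ℝ) h x₀) (v : TangentSpace 𝓘(ℝ, E) x₀) :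
    mvfderiv 𝓘(ℝ, E) h x₀ v
      = fderiv ℝ (fun y ↦ h ((extChartAt 𝓘(ℝ, E) x₀).symm y)) (extChartAt 𝓘(ℝ, E) x₀ x₀) v := by
  have h1 : mfderiv 𝓘(ℝ, E) 𝓘(ℝ, ℝ) h x₀
      = fderiv ℝ (fun y ↦ h ((extChartAt 𝓘(ℝ, E) x₀).symm y)) (extChartAt 𝓘(ℝ, E) x₀ x₀) := by
    rw [hh.mfderiv, modelWithCornersSelf_coe, range_id, fderivWithin_univ]
    rfl
  exact congrArg (fun T : E →L[ℝ] ℝ ↦ T v) h1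

/-- In finite dimension it suffices to test components, which are the values of `α` on the fields
`extend E v`. -/
lemma differentiableAt_coordForm (hα : SmoothOneFormAt α x₀) :
    DifferentiableAt ℝ (coordForm x₀ α) (extChartAt 𝓘(ℝ, E) x₀ x₀) := by
  refine differentiableAt_clm_of_apply fun v ↦ ?_
  refine (differentiableAt_comp_extChartAt_symm (hα.mdiff
    (mdifferentiableAt_extend 𝓘(ℝ, E) E (show TangentSpace 𝓘(ℝ, E) x₀ from v)))
    ).congr_of_eventuallyEq ?_
  filter_upwards [target_mem_nhds] with y hy
  exact coordForm_apply_eq v hy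

lemma differentiableAt_coordBilin (hg : SmoothTwoTensor g) :
    DifferentiableAt ℝ (coordBilin x₀ g) (extChartAt 𝓘(ℝ, E) x₀ x₀) := by
  refine differentiableAt_clm_of_apply fun v ↦ differentiableAt_clm_of_apply fun w ↦ ?_
  refine (differentiableAt_comp_extChartAt_symm (hg.mdiff
    (mdifferentiableAt_extend 𝓘(ℝ, E) E (show TangentSpace 𝓘(ℝ, E) x₀ from v))
    (mdifferentiableAt_extend 𝓘(ℝ, E) E (show TangentSpace 𝓘(ℝ, E) x₀ from w)))
    ).congr_of_eventuallyEq ?_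
  filter_upwards [target_mem_nhds] with y hy
  exact coordBilin_apply_eq v w hy

/-- The bracket on a manifold is defined through this pullback by the inverse chart; inverting its
derivative is the same as applying the derivative of the chart. -/
lemma mpullbackWithin_eq_coordVec {y : E} (hy : y ∈ (extChartAt 𝓘(ℝ, E) x₀).target) :
    mpullbackWithin 𝓘(ℝ, E) 𝓘(ℝ, E) (extChartAt 𝓘(ℝ, E) x₀).symm X (range 𝓘(ℝ, E)) y
      = coordVec x₀ X y := by
  have hinv := isInvertible_mfderivWithin_extChartAt_symm (I := 𝓘(ℝ, E)) hy
  have h := mfderivWithin_symm_mfderiv_apply ((extChartAt 𝓘(ℝ, E) x₀).map_target hy)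
    (X ((extChartAt 𝓘(ℝ, E) x₀).symm y))
  rw [(extChartAt 𝓘(ℝ, E) x₀).right_inv hy] at h
  exact hinv.inverse_apply_eq.2 h.symm

lemma mpullbackWithin_eventuallyEq_coordVec :
    mpullbackWithin 𝓘(ℝ, E) 𝓘(ℝ, E) (extChartAt 𝓘(ℝ, E) x₀).symm X (range 𝓘(ℝ, E))
      =ᶠ[𝓝 (extChartAt 𝓘(ℝ, E) x₀ x₀)] coordVec x₀ X := by
  filter_upwards [target_mem_nhds] with y hy
  exact mpullbackWithin_eq_coordVec hy

lemma differentiableAt_coordVec (hX : MDiffAt (T% X) x₀) :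
    DifferentiableAt ℝ (coordVec x₀ X) (extChartAt 𝓘(ℝ, E) x₀ x₀) := by
  have : IsManifold 𝓘(ℝ, E) 2 M := IsManifold.of_le (n := ∞) (by norm_cast)
  have h := (mdifferentiableWithinAt_univ.2 hX).differentiableWithinAt_mpullbackWithin_vectorField
  have h0 : (extChartAt 𝓘(ℝ, E) x₀).symm ⁻¹' univ ∩ range 𝓘(ℝ, E) = univ := by simp
  rw [h0] at h
  exact (differentiableWithinAt_univ.1 h).congr_of_eventuallyEq
    mpullbackWithin_eventuallyEq_coordVec.symm

/-- The derivative of the coordinates of a vector field in the chart at `x₀`. -/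
def coordDeriv (x₀ : M) (X : Π x : M, TangentSpace 𝓘(ℝ, E) x) :
    TangentSpace 𝓘(ℝ, E) x₀ →L[ℝ] TangentSpace 𝓘(ℝ, E) x₀ :=
  fderiv ℝ (E := E) (F := E) (coordVec x₀ X) (extChartAt 𝓘(ℝ, E) x₀ x₀)

/-- The derivative of the coordinates of a one-form in the chart at `x₀`. -/
def formDeriv (x₀ : M) (α : Π x : M, TangentSpace 𝓘(ℝ, E) x →L[ℝ] ℝ) :
    TangentSpace 𝓘(ℝ, E) x₀ →L[ℝ] TangentSpace 𝓘(ℝ, E) x₀ →L[ℝ] ℝ :=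
  fderiv ℝ (E := E) (F := E →L[ℝ] ℝ) (coordForm x₀ α) (extChartAt 𝓘(ℝ, E) x₀ x₀)

/-- The derivative of the coordinates of a `(0,2)`-tensor in the chart at `x₀`. -/
def tensorDeriv (x₀ : M)
    (g : Π x : M, TangentSpace 𝓘(ℝ, E) x →L[ℝ] TangentSpace 𝓘(ℝ, E) x →L[ℝ] ℝ) :
    TangentSpace 𝓘(ℝ, E) x₀ →L[ℝ] TangentSpace 𝓘(ℝ, E) x₀ →L[ℝ] TangentSpace 𝓘(ℝ, E) x₀ →L[ℝ] ℝ :=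
  fderiv ℝ (E := E) (F := E →L[ℝ] E →L[ℝ] ℝ) (coordBilin x₀ g) (extChartAt 𝓘(ℝ, E) x₀ x₀)

/-- By definition the bracket is that of the pulled-back fields, transported by the inverse
derivative of the chart, which is the identity at `x₀`. -/
lemma mlieBracket_eq_coordDeriv :
    mlieBracket 𝓘(ℝ, E) X Y x₀
      = coordDeriv x₀ Y (X x₀)
        - coordDeriv x₀ X (Y x₀) := by
  have h0 : mlieBracket 𝓘(ℝ, E) X Y x₀ = lieBracket ℝ (coordVec x₀ X) (coordVec x₀ Y)
      (extChartAt 𝓘(ℝ, E) x₀ x₀) := by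
    have h1 : (extChartAt 𝓘(ℝ, E) x₀).symm ⁻¹' univ ∩ range 𝓘(ℝ, E) = univ := by simp
    have h2 : lieBracketWithin ℝ (E := E)
        (mpullbackWithin 𝓘(ℝ, E) 𝓘(ℝ, E) (extChartAt 𝓘(ℝ, E) x₀).symm X (range 𝓘(ℝ, E)))
        (mpullbackWithin 𝓘(ℝ, E) 𝓘(ℝ, E) (extChartAt 𝓘(ℝ, E) x₀).symm Y (range 𝓘(ℝ, E)))
        univ (extChartAt 𝓘(ℝ, E) x₀ x₀)
        = lieBracket ℝ (coordVec x₀ X) (coordVec x₀ Y) (extChartAt 𝓘(ℝ, E) x₀ x₀) := by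
      refine Eq.trans (congrFun (lieBracketWithin_univ (𝕜 := ℝ) (E := E)) _) ?_
      exact Filter.EventuallyEq.lieBracket_vectorField_eq
        mpullbackWithin_eventuallyEq_coordVec mpullbackWithin_eventuallyEq_coordVec
    rw [mlieBracket, mlieBracketWithin_apply, h1, mfderiv_extChartAt_self]
    refine Eq.trans (congrArg (fun T : E →L[ℝ] E ↦ T _)
      (ContinuousLinearMap.inverse_id (R := ℝ) (M := E))) ?_
    exact h2
  rw [h0, lieBracket, coordVec_self, coordVec_self]
  rfl

lemma mvfderiv_form_apply (hα : SmoothOneFormAt α x₀) (hX : MDiffAt (T% X) x₀)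
    (v : TangentSpace 𝓘(ℝ, E) x₀) :
    mvfderiv 𝓘(ℝ, E) (fun y ↦ α y (X y)) x₀ v
      = formDeriv x₀ α v (X x₀)
        + α x₀ (coordDeriv x₀ X v) := by
  obtain ⟨T, hT, hT'⟩ := hasFDerivAt_covector_comp (f := fun y : E ↦ y)
    (differentiableAt_coordForm hα) (hasFDerivAt_id _) (differentiableAt_coordVec hX).hasFDerivAt
  have h := hT.congr_of_eventuallyEq (f₁ := fun y ↦ α ((extChartAt 𝓘(ℝ, E) x₀).symm y)
    (X ((extChartAt 𝓘(ℝ, E) x₀).symm y)))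
    (by filter_upwards [target_mem_nhds] with y hy using (coordForm_coordVec hy).symm)
  rw [mvfderiv_apply_eq_fderiv (hα.mdiff hX), h.fderiv]
  refine (hT' v).trans ?_
  rw [coordForm_self, coordVec_self]
  rfl

lemma mvfderiv_tensor_apply (hg : SmoothTwoTensor g) (hX : MDiffAt (T% X) x₀)
    (hY : MDiffAt (T% Y) x₀) (v : TangentSpace 𝓘(ℝ, E) x₀) :
    mvfderiv 𝓘(ℝ, E) (fun y ↦ g y (X y) (Y y)) x₀ v
      = tensorDeriv x₀ g v (X x₀) (Y x₀)
        + g x₀ (coordDeriv x₀ X v) (Y x₀)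
        + g x₀ (X x₀) (coordDeriv x₀ Y v) := by
  obtain ⟨T, hT, hT'⟩ := hasFDerivAt_bilin_comp (f := fun y : E ↦ y)
    (differentiableAt_coordBilin hg) (hasFDerivAt_id _) (differentiableAt_coordVec hX).hasFDerivAt
    (differentiableAt_coordVec hY).hasFDerivAt
  have h := hT.congr_of_eventuallyEq (f₁ := fun y ↦ g ((extChartAt 𝓘(ℝ, E) x₀).symm y)
    (X ((extChartAt 𝓘(ℝ, E) x₀).symm y)) (Y ((extChartAt 𝓘(ℝ, E) x₀).symm y)))
    (by filter_upwards [target_mem_nhds] with y hy using (coordBilin_coordVec hy).symm)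
  rw [mvfderiv_apply_eq_fderiv (hg.mdiff hX hY), h.fderiv]
  refine (hT' v).trans ?_
  rw [coordBilin_self, coordVec_self, coordVec_self]
  rfl

lemma mdiff_extend (v : TangentSpace 𝓘(ℝ, E) x₀) : MDiffAt (T% (extend E v)) x₀ :=
  mdifferentiableAt_extend 𝓘(ℝ, E) E v

lemma coordDeriv_extend (v : TangentSpace 𝓘(ℝ, E) x₀) :
    coordDeriv x₀ (extend E v) = 0 := by
  rw [coordDeriv, (coordVec_extend v).fderiv_eq]
  exact fderiv_const_apply (𝕜 := ℝ) (E := E) (F := E) v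

/-- Testing on `extend E v`, whose coordinate derivative is zero, leaves only derivatives of `α` and
`X`. The formulas for `extD` and `lieTensor` come from the same device. -/
lemma lieForm_eq_formDeriv (hα : SmoothOneFormAt α x₀)
    (v : TangentSpace 𝓘(ℝ, E) x₀) :
    lieForm X α x₀ v = formDeriv x₀ α (X x₀) v
      + α x₀ (coordDeriv x₀ X v) := by
  have h := lieForm_apply (X := X) hα (mdiff_extend v)
  rw [mvfderiv_form_apply hα (mdiff_extend v), mlieBracket_eq_coordDeriv,
    coordDeriv_extend, extend_apply_self] at h
  rw [h]
  simp

lemma extD_eq_formDeriv (hα : SmoothOneFormAt α x₀) (v w : TangentSpace 𝓘(ℝ, E) x₀) :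
    extD α x₀ v w = formDeriv x₀ α v w
      - formDeriv x₀ α w v := by
  have h := extD_apply hα (mdiff_extend v) (mdiff_extend w)
  rw [mvfderiv_form_apply hα (mdiff_extend v), mvfderiv_form_apply hα (mdiff_extend w),
    mlieBracket_eq_coordDeriv, coordDeriv_extend, coordDeriv_extend,
    extend_apply_self, extend_apply_self] at h
  rw [h]
  simp

lemma lieTensor_eq_tensorDeriv (hg : SmoothTwoTensor g) (v w : TangentSpace 𝓘(ℝ, E) x₀) :
    lieTensor Z g x₀ v w
      = tensorDeriv x₀ g (Z x₀) v w
        + g x₀ (coordDeriv x₀ Z v) w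
        + g x₀ v (coordDeriv x₀ Z w) := by
  have h := lieTensor_apply (Z := Z) hg (mdiff_extend v) (mdiff_extend w)
  rw [mvfderiv_tensor_apply hg (mdiff_extend v) (mdiff_extend w),
    mlieBracket_eq_coordDeriv, mlieBracket_eq_coordDeriv, coordDeriv_extend,
    coordDeriv_extend, extend_apply_self, extend_apply_self] at h
  rw [h]
  simp

end Coordinates

/-! ### Two-parameter maps: Lagrangian, acceleration and covariant derivative in a chart. -/

section Variation

variable {E : Type*} [NormedAddCommGroup E] [NormedSpace ℝ E] [FiniteDimensional ℝ E]
  {M : Type*} [TopologicalSpace M] [ChartedSpace E M] [IsManifold 𝓘(ℝ, E) ∞ M]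

/-- The derivative of the two-parameter map `f` in the direction `d`. -/
def partialField (f : ℝ × ℝ → M) (Ω : Set (ℝ × ℝ)) (d z : ℝ × ℝ) : TangentSpace 𝓘(ℝ, E) (f z) :=
  mfderivWithin 𝓘(ℝ, ℝ × ℝ) 𝓘(ℝ, E) f Ω z d

variable {f : ℝ × ℝ → M} {Ω : Set (ℝ × ℝ)} {z₀ : ℝ × ℝ}
  {α : Π x : M, TangentSpace 𝓘(ℝ, E) x →L[ℝ] ℝ}
  {g : Π x : M, TangentSpace 𝓘(ℝ, E) x →L[ℝ] TangentSpace 𝓘(ℝ, E) x →L[ℝ] ℝ}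

lemma contDiffAt_chart_comp {n : WithTop ℕ∞} (hn : n ≤ ∞)
    (hf : ContMDiffOn 𝓘(ℝ, ℝ × ℝ) 𝓘(ℝ, E) ∞ f Ω) (hΩ : Ω ∈ 𝓝 z₀) :
    ContDiffAt ℝ n (fun z ↦ extChartAt 𝓘(ℝ, E) (f z₀) (f z)) z₀ := by
  have h1 : ContMDiffAt 𝓘(ℝ, ℝ × ℝ) 𝓘(ℝ, E) n f z₀ := (hf.contMDiffAt hΩ).of_le hn
  have h2 : ContMDiffAt 𝓘(ℝ, E) 𝓘(ℝ, E) n (extChartAt 𝓘(ℝ, E) (f z₀)) (f z₀) :=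
    (contMDiffAt_extChartAt (n := ∞)).of_le hn
  exact (h2.comp z₀ h1).contDiffAt

/-- Needed on a neighbourhood of `z₀` in one fixed chart, because these expressions are then
differentiated once more. -/
lemma eventually_mfderiv_partialField (hf : ContMDiffOn 𝓘(ℝ, ℝ × ℝ) 𝓘(ℝ, E) ∞ f Ω)
    (hΩ : Ω ∈ 𝓝 z₀) :
    ∀ᶠ z in 𝓝 z₀, f z ∈ (extChartAt 𝓘(ℝ, E) (f z₀)).source ∧ ∀ d : ℝ × ℝ,
      mfderiv 𝓘(ℝ, E) 𝓘(ℝ, E) (extChartAt 𝓘(ℝ, E) (f z₀)) (f z) (partialField f Ω d z)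
        = fderiv ℝ (fun z ↦ extChartAt 𝓘(ℝ, E) (f z₀) (f z)) z d := by
  have hc : ContinuousAt f z₀ := (hf.contMDiffAt hΩ).continuousAt
  filter_upwards [hc.preimage_mem_nhds (extChartAt_source_mem_nhds (I := 𝓘(ℝ, E)) (f z₀)),
    eventually_mem_nhds_iff.2 hΩ] with z hz hzΩ
  refine ⟨hz, fun d ↦ ?_⟩
  have h1 : MDifferentiableAt 𝓘(ℝ, ℝ × ℝ) 𝓘(ℝ, E) f z :=
    (hf.contMDiffAt hzΩ).mdifferentiableAt (by simp)
  have h2 : MDifferentiableAt 𝓘(ℝ, E) 𝓘(ℝ, E) (extChartAt 𝓘(ℝ, E) (f z₀)) (f z) :=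
    mdifferentiableAt_extChartAt (by rwa [mem_preimage, extChartAt_source] at hz)
  have h3 := mfderiv_comp z h2 h1
  rw [partialField, mfderivWithin_of_mem_nhds hzΩ]
  rw [mfderiv_eq_fderiv] at h3
  exact (congrArg (fun T : (ℝ × ℝ) →L[ℝ] E ↦ T d) h3).symm

/-- The coordinate acceleration of the curve `t ↦ f (s, t)` in the chart at `f z₀`. -/
def coordAccel (f : ℝ × ℝ → M) (z₀ : ℝ × ℝ) : TangentSpace 𝓘(ℝ, E) (f z₀) :=
  fderiv ℝ (F := (ℝ × ℝ) →L[ℝ] E) (fderiv ℝ fun z ↦ extChartAt 𝓘(ℝ, E) (f z₀) (f z)) z₀ (0, 1) (0, 1)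

lemma fderiv_chart_eq_partialField (hf : ContMDiffOn 𝓘(ℝ, ℝ × ℝ) 𝓘(ℝ, E) ∞ f Ω)
    (hΩ : Ω ∈ 𝓝 z₀) (d : ℝ × ℝ) :
    fderiv ℝ (fun z ↦ extChartAt 𝓘(ℝ, E) (f z₀) (f z)) z₀ d = partialField f Ω d z₀ := by
  rw [← (eventually_mfderiv_partialField hf hΩ).self_of_nhds.2 d, mfderiv_extChartAt_self]
  rfl

/-- The derivative of the integrand of `∫ ½ g(ċ, ċ) - α(ċ)` along a variation, up to the
`t`-derivative of `g(ċ, w) - α(w)`. -/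
lemma fderiv_lagrangian_sub (hf : ContMDiffOn 𝓘(ℝ, ℝ × ℝ) 𝓘(ℝ, E) ∞ f Ω) (hΩ : Ω ∈ 𝓝 z₀)
    (hg : SmoothTwoTensor g) (hsymm : ∀ x v w, g x v w = g x w v)
    (hα : SmoothOneFormAt α (f z₀)) {v w : TangentSpace 𝓘(ℝ, E) (f z₀)}
    (hv : partialField f Ω (0, 1) z₀ = v) (hw : partialField f Ω (1, 0) z₀ = w) :
    fderiv ℝ (fun z ↦ (1 / 2 : ℝ) * g (f z) (partialField f Ω (0, 1) z) (partialField f Ω (0, 1) z)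
        - α (f z) (partialField f Ω (0, 1) z)) z₀ (1, 0)
      - fderiv ℝ (fun z ↦ g (f z) (partialField f Ω (0, 1) z) (partialField f Ω (1, 0) z)
        - α (f z) (partialField f Ω (1, 0) z)) z₀ (0, 1)
      = 1 / 2 * tensorDeriv (f z₀) g w v v - tensorDeriv (f z₀) g v v w
        - g (f z₀) (coordAccel f z₀) w + formDeriv (f z₀) α v w - formDeriv (f z₀) α w v := by
  have hev := eventually_mfderiv_partialField hf hΩ
  have h := fderiv_lagrangian_sub_fderiv_boundary (G := coordBilin (f z₀) g)
    (A := coordForm (f z₀) α) (contDiffAt_chart_comp (n := 2) (by norm_cast) hf hΩ)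
    (differentiableAt_coordBilin hg) (differentiableAt_coordForm hα)
    (by rw [coordBilin_self]; exact hsymm _)
    ((fderiv_chart_eq_partialField hf hΩ _).trans hv)
    ((fderiv_chart_eq_partialField hf hΩ _).trans hw)
  rw [coordBilin_self] at h
  refine (congrArg₂ (· - ·)
    (congrArg (fun T : (ℝ × ℝ) →L[ℝ] ℝ ↦ T (1, 0)) (Filter.EventuallyEq.fderiv_eq ?_))
    (congrArg (fun T : (ℝ × ℝ) →L[ℝ] ℝ ↦ T (0, 1)) (Filter.EventuallyEq.fderiv_eq ?_))).trans h
  · filter_upwards [hev] with z hz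
    simp only [← hz.2, coordBilin_apply hz.1, coordForm_apply hz.1]
  · filter_upwards [hev] with z hz
    simp only [← hz.2, coordBilin_apply hz.1, coordForm_apply hz.1]

/-- If `α` vanishes on the velocity of a curve, its derivative along the curve vanishes as well. -/
lemma formDeriv_add_accel_eq_zero (hf : ContMDiffOn 𝓘(ℝ, ℝ × ℝ) 𝓘(ℝ, E) ∞ f Ω) (hΩ : Ω ∈ 𝓝 z₀)
    (hα : SmoothOneFormAt α (f z₀)) {v : TangentSpace 𝓘(ℝ, E) (f z₀)}
    (hv : partialField f Ω (0, 1) z₀ = v)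
    (h0 : ∀ᶠ t in 𝓝 z₀.2, α (f (z₀.1, t)) (partialField f Ω (0, 1) (z₀.1, t)) = 0) :
    formDeriv (f z₀) α v v + α (f z₀) (coordAccel f z₀) = 0 := by
  have hev := eventually_mfderiv_partialField hf hΩ
  have hC := contDiffAt_chart_comp (n := 2) (by norm_cast) hf hΩ
  have hf1 := (hC.differentiableAt (by simp)).hasFDerivAt
  have hf2 := ((hC.fderiv_right (m := 1) (by norm_num)).differentiableAt (by simp)).hasFDerivAt
  have hft := hf2.clm_apply (hasFDerivAt_const ((0, 1) : ℝ × ℝ) z₀)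
  obtain ⟨T, hT, hT'⟩ := hasFDerivAt_covector_comp
    (f := fun z ↦ extChartAt 𝓘(ℝ, E) (f z₀) (f z)) (differentiableAt_coordForm hα) hf1 hft
  have hl : HasDerivAt (fun t : ℝ ↦ (z₀.1, t)) ((0 : ℝ), (1 : ℝ)) z₀.2 :=
    (hasDerivAt_const _ _).prodMk (hasDerivAt_id _)
  have hd := HasFDerivAt.comp_hasDerivAt (f := fun t : ℝ ↦ (z₀.1, t)) z₀.2 hT hl
  -- `T (0, 1)` is also the derivative of a function of `t` that vanishes near `z₀.2`.
  have hd0 : HasDerivAt (fun _ : ℝ ↦ (0 : ℝ)) (T (0, 1)) z₀.2 := by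
    refine hd.congr_of_eventuallyEq ?_
    have hcont : Filter.Tendsto (fun t : ℝ ↦ (z₀.1, t)) (𝓝 z₀.2) (𝓝 z₀) := hl.continuousAt
    filter_upwards [h0, hcont.eventually hev] with t ht hz
    simp only [Function.comp_apply, ← hz.2, coordForm_apply hz.1, ht]
  have hT0 := hd0.unique (hasDerivAt_const _ _)
  rw [hT', fderiv_chart_eq_partialField hf hΩ, hv, coordForm_self] at hT0
  simp only [add_apply, ContinuousLinearMap.comp_apply,
    zero_apply, map_zero, zero_add, ContinuousLinearMap.flip_apply] at hT0
  exact hT0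

/-- The components of the velocity in the chart at `f (s, t)` are the first derivatives of the
coordinate curve, so their derivative is its acceleration; the `nabla` term is the Christoffel
correction. -/
lemma covDerivAlong_eq_coordAccel
    (nabla : CovariantDerivative 𝓘(ℝ, E) E (TangentSpace 𝓘(ℝ, E) : M → Type _))
    (hf : ContMDiffOn 𝓘(ℝ, ℝ × ℝ) 𝓘(ℝ, E) ∞ f Ω) {s t : ℝ} (hΩ : Ω ∈ 𝓝 (s, t))
    (ht : t ∈ Ioo (0 : ℝ) 1)
    (hvel : ∀ u ∈ Ioo (0 : ℝ) 1,
      velocity (E := E) (fun u ↦ f (s, u)) u = partialField f Ω (0, 1) (s, u)) :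
    covDerivAlong nabla (fun u ↦ f (s, u)) (velocity fun u ↦ f (s, u)) t
      = coordAccel f (s, t) + nabla (extend E (partialField f Ω (0, 1) (s, t))) (f (s, t))
          (partialField f Ω (0, 1) (s, t)) := by
  rw [covDerivAlong, hvel t ht]
  congr 1
  have hev := eventually_mfderiv_partialField hf hΩ
  have hC := contDiffAt_chart_comp (n := 2) (by norm_cast) hf hΩ
  have hf2 := ((hC.fderiv_right (m := 1) (by norm_num)).differentiableAt (by simp)).hasFDerivAt
  have hft := hf2.clm_apply (hasFDerivAt_const ((0, 1) : ℝ × ℝ) (s, t))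
  have hl : HasDerivAt (fun t : ℝ ↦ (s, t)) ((0 : ℝ), (1 : ℝ)) t :=
    (hasDerivAt_const _ _).prodMk (hasDerivAt_id _)
  have hd := HasFDerivAt.comp_hasDerivAt (f := fun t : ℝ ↦ (s, t)) t hft hl
  have hcont : Filter.Tendsto (fun t : ℝ ↦ (s, t)) (𝓝 t) (𝓝 (s, t)) := hl.continuousAt
  have hd' : HasDerivAt (fun u ↦ ((trivializationAt E (TangentSpace 𝓘(ℝ, E)) (f (s, t)))
      (⟨f (s, u), velocity (fun u ↦ f (s, u)) u⟩ : TangentBundle 𝓘(ℝ, E) M)).2)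
      (coordAccel f (s, t) : E) t := by
    refine (hd.congr_of_eventuallyEq ?_).congr_deriv ?_
    · filter_upwards [hcont.eventually hev, Ioo_mem_nhds ht.1 ht.2] with u hu hu'
      rw [hvel u hu', Function.comp_apply, ← hu.2, trivializationAt_apply_snd hu.1]
    · simp [coordAccel]
  rw [(hd'.hasDerivWithinAt).derivWithin (uniqueDiffOn_Icc zero_lt_one t (Ioo_subset_Icc_self ht))]
  exact trivializationAt_self_symm _

end Variation

/-! ### The canonical connection on the horizontal bundle, and derivatives of the forms. -/

section WittAlgebra

variable {E : Type*} [NormedAddCommGroup E] [NormedSpace ℝ E] [FiniteDimensional ℝ E]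
  {M : Type*} [TopologicalSpace M] [ChartedSpace E M] [IsManifold 𝓘(ℝ, E) ∞ M]

/-- A vector in a smooth subbundle extends to a local smooth section. -/
lemma IsSmoothSubbundle.exists_section {V : Π x : M, Submodule ℝ (TangentSpace 𝓘(ℝ, E) x)} {n : ℕ}
    (hV : IsSmoothSubbundle V n) {x : M} {v : TangentSpace 𝓘(ℝ, E) x} (hv : v ∈ V x) :
    ∃ X : Π x : M, TangentSpace 𝓘(ℝ, E) x,
      SmoothFieldAt X x ∧ X x = v ∧ ∀ᶠ y in 𝓝 x, X y ∈ V y := by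
  obtain ⟨U, hU, hxU, e, he, hspan⟩ := hV x
  rw [← (hspan x hxU).2, Submodule.mem_span_range_iff_exists_fun] at hv
  obtain ⟨c, hc⟩ := hv
  refine ⟨fun y ↦ ∑ i, c i • e i y, ?_, hc, ?_⟩
  · have h := ContMDiffAt.sum_section (I := 𝓘(ℝ, E)) (F := E) (n := ∞) (x₀ := x)
      (V := (TangentSpace 𝓘(ℝ, E) : M → Type _)) (s := Finset.univ)
      (t := fun i y ↦ c i • e i y) fun i _ ↦ (he i x hxU).const_smul_section
    exact h
  · filter_upwards [hU.mem_nhds hxU] with y hy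
    rw [← (hspan y hy).2]
    exact Submodule.sum_mem _ fun i _ ↦
      Submodule.smul_mem _ _ (Submodule.subset_span (mem_range_self i))

lemma IsSmoothSubbundle.exists_smul_eq {V : Π x : M, Submodule ℝ (TangentSpace 𝓘(ℝ, E) x)}
    (hV : IsSmoothSubbundle V 1) {x : M} {v w : TangentSpace 𝓘(ℝ, E) x} (hv : v ∈ V x)
    (hv0 : v ≠ 0) (hw : w ∈ V x) : ∃ c : ℝ, c • v = w := by
  obtain ⟨U, hU, hxU, e, he, hspan⟩ := hV x
  have h := finrank_span_eq_card (hspan x hxU).1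
  rw [(hspan x hxU).2, Fintype.card_fin] at h
  obtain ⟨c, hc⟩ := (finrank_eq_one_iff_of_nonzero' (⟨v, hv⟩ : V x)
    (by simpa using hv0)).1 h ⟨w, hw⟩
  exact ⟨c, congrArg Subtype.val hc⟩

namespace WittStructure

variable {g : PseudoRiemannianMetric E M} {r s : ℕ} (S : WittStructure g r s)

lemma proj_mem (i : Index r s) (x : M) (v : TangentSpace 𝓘(ℝ, E) x) : S.proj i x v ∈ S.V i x :=
  Subtype.mem _

lemma sum_proj (x : M) (v : TangentSpace 𝓘(ℝ, E) x) : ∑ i, S.proj i x v = v := by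
  obtain ⟨d, rfl⟩ := (S.sumEquiv x).surjective v
  induction d using DirectSum.induction_on with
  | zero => simp
  | of i a =>
    have h : S.sumEquiv x (DirectSum.of (fun i ↦ S.V i x) i a) = a :=
      DirectSum.coeLinearMap_lof (fun i ↦ S.V i x) i a
    rw [h]
    simp [S.proj_of_mem a.2]
  | add a b ha hb => rw [map_add]; simp only [map_add, Finset.sum_add_distrib, ha, hb]

/-- The torsion of two vectors of `V_{q_l}` is orthogonal to `V_{q_l}`. -/
lemma inner_torsion_eq_zero
    {nabla : CovariantDerivative 𝓘(ℝ, E) E (TangentSpace 𝓘(ℝ, E) : M → Type _)}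
    (hnabla : S.IsCanonicalConnection nabla) {l : Fin r} {x : M} {u v w : TangentSpace 𝓘(ℝ, E) x}
    (hu : u ∈ S.V (Index.q l) x) (hv : v ∈ S.V (Index.q l) x) (hw : w ∈ S.V (Index.q l) x) :
    g.inner x (nabla.torsion x u v) w = 0 := by
  obtain ⟨X, hX, rfl, hX'⟩ := (S.subbundle (Index.q l)).exists_section hu
  obtain ⟨Y, hY, rfl, hY'⟩ := (S.subbundle (Index.q l)).exists_section hv
  rw [hnabla.torsion_eq _ _ x X Y hX hY hX' hY']
  -- For `i = j = q_l` both `tau` terms vanish by definition, and only components with `k ≠ q_l`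
  -- remain. These are orthogonal to `V_{q_l}` because `q_l` is its own `star`.
  have h0 : ∀ k ∈ Finset.univ.filter (fun k : Index r s ↦ k ≠ Index.q l ∧ k ≠ Index.q l),
      g.inner x (S.proj k x (mlieBracket 𝓘(ℝ, E) X Y x)) w = 0 := fun k hk ↦ by
    refine S.orthogonal k (Index.q l) ?_ x _ (S.proj_mem _ _ _) w hw
    rcases k with k | ⟨k, b⟩
    · simpa [Index.star, eq_comm] using hk
    · simp [Index.star]
  simp only [tau, if_true, add_zero, sub_zero, map_neg, map_sum, neg_apply,
    sum_apply, Finset.sum_eq_zero h0, neg_zero]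

/-- Fields with constant coefficients commute, so their torsion is the antisymmetric part of the
Christoffel term, and `inner_torsion_eq_zero` kills its pairing with `V_{q_l}`. This replaces
torsion-freeness of the Levi-Civita connection. -/
lemma inner_nabla_extend_symm
    {nabla : CovariantDerivative 𝓘(ℝ, E) E (TangentSpace 𝓘(ℝ, E) : M → Type _)}
    (hnabla : S.IsCanonicalConnection nabla) {l : Fin r} {x : M} {u v w : TangentSpace 𝓘(ℝ, E) x}
    (hu : u ∈ S.V (Index.q l) x) (hv : v ∈ S.V (Index.q l) x) (hw : w ∈ S.V (Index.q l) x) :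
    g.inner x (nabla (extend E v) x u) w = g.inner x (nabla (extend E u) x v) w := by
  have h := S.inner_torsion_eq_zero hnabla hu hv hw
  rw [nabla.torsion_apply_eq_extend, mlieBracket_eq_coordDeriv, coordDeriv_extend,
    coordDeriv_extend, extend_apply_self, extend_apply_self] at h
  simp only [map_sub, sub_apply, zero_apply, sub_zero] at h
  linarith

/-- Metric compatibility on constant-coefficient fields, where the derivative of `g(X, Y)` sees only
the components of `g`. -/
lemma tensorDeriv_eq_nabla_extend
    {nabla : CovariantDerivative 𝓘(ℝ, E) E (TangentSpace 𝓘(ℝ, E) : M → Type _)}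
    (hnabla : S.IsCanonicalConnection nabla) {x : M} (u v w : TangentSpace 𝓘(ℝ, E) x) :
    tensorDeriv x g.inner u v w
      = g.inner x (nabla (extend E v) x u) w + g.inner x v (nabla (extend E w) x u) := by
  have h := hnabla.metric x (extend E v) (extend E w)
    (contMDiffAt_extend 𝓘(ℝ, E) E v) (contMDiffAt_extend 𝓘(ℝ, E) E w) u
  rw [mvfderiv_tensor_apply g.smooth (mdiff_extend v) (mdiff_extend w), coordDeriv_extend,
    coordDeriv_extend, extend_apply_self, extend_apply_self] at h
  simpa using h

end WittStructure

lemma SmoothFieldAt.mdiff {X : Π x : M, TangentSpace 𝓘(ℝ, E) x} {x : M} (hX : SmoothFieldAt X x) :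
    MDiffAt (T% X) x :=
  hX.mdifferentiableAt (by simp)

lemma formDeriv_flat (g : PseudoRiemannianMetric E M) {X : Π x : M, TangentSpace 𝓘(ℝ, E) x} {x : M}
    (hX : SmoothFieldAt X x) (u v : TangentSpace 𝓘(ℝ, E) x) :
    formDeriv x (g.flat X) u v
      = tensorDeriv x g.inner u (X x) v + g.inner x (coordDeriv x X u) v := by
  have h1 := mvfderiv_form_apply (g.flat_smooth hX) (mdiff_extend v) u
  have h2 := mvfderiv_tensor_apply g.smooth hX.mdiff (mdiff_extend v) u
  rw [coordDeriv_extend, extend_apply_self] at h1 h2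
  have h3 : mvfderiv 𝓘(ℝ, E) (fun y ↦ g.flat X y (extend E v y)) x u
      = mvfderiv 𝓘(ℝ, E) (fun y ↦ g.inner y (X y) (extend E v y)) x u := rfl
  simp only [zero_apply, map_zero, add_zero] at h1 h2
  rw [← h1, h3, h2]

/-- If `α(X)` is constant, the product rule gives a relation between the derivatives. -/
lemma formDeriv_add_of_const {α : Π x : M, TangentSpace 𝓘(ℝ, E) x →L[ℝ] ℝ}
    {X : Π x : M, TangentSpace 𝓘(ℝ, E) x} {x : M} (hα : SmoothOneFormAt α x)
    (hX : SmoothFieldAt X x) {k : ℝ} (hk : ∀ y, α y (X y) = k) (u : TangentSpace 𝓘(ℝ, E) x) :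
    formDeriv x α u (X x) + α x (coordDeriv x X u) = 0 := by
  rw [← mvfderiv_form_apply hα hX.mdiff, funext hk, mvfderiv_const]
  rfl

variable {lam₁ lam₂ : M → ℝ} {σ τ : Π x : M, TangentSpace 𝓘(ℝ, E) x →L[ℝ] ℝ} {x : M}

lemma smoothOneFormAt_alphaForm (h₁ : ContMDiff 𝓘(ℝ, E) 𝓘(ℝ, ℝ) ∞ lam₁)
    (h₂ : ContMDiff 𝓘(ℝ, E) 𝓘(ℝ, ℝ) ∞ lam₂) (hσ : SmoothOneFormAt σ x) (hτ : SmoothOneFormAt τ x) :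
    SmoothOneFormAt (alphaForm lam₁ lam₂ σ τ) x :=
  ((h₁ x).smul_section hσ).add_section ((h₂ x).smul_section hτ)

lemma formDeriv_alphaForm (h₁ : ContMDiff 𝓘(ℝ, E) 𝓘(ℝ, ℝ) ∞ lam₁)
    (h₂ : ContMDiff 𝓘(ℝ, E) 𝓘(ℝ, ℝ) ∞ lam₂) (hσ : SmoothOneFormAt σ x) (hτ : SmoothOneFormAt τ x)
    (u v : TangentSpace 𝓘(ℝ, E) x) :
    formDeriv x (alphaForm lam₁ lam₂ σ τ) u v
      = mvfderiv 𝓘(ℝ, E) lam₁ x u * σ x v + lam₁ x * formDeriv x σ u v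
        + (mvfderiv 𝓘(ℝ, E) lam₂ x u * τ x v + lam₂ x * formDeriv x τ u v) := by
  have hd : ∀ {α : Π x : M, TangentSpace 𝓘(ℝ, E) x →L[ℝ] ℝ}, SmoothOneFormAt α x →
      mvfderiv 𝓘(ℝ, E) (fun y ↦ α y (extend E v y)) x u = formDeriv x α u v := fun hα ↦ by
    rw [mvfderiv_form_apply hα (mdiff_extend v), coordDeriv_extend, extend_apply_self]
    simp
  have m₁ : MDifferentiableAt 𝓘(ℝ, E) 𝓘(ℝ, ℝ) lam₁ x := (h₁ x).mdifferentiableAt (by simp)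
  have m₂ : MDifferentiableAt 𝓘(ℝ, E) 𝓘(ℝ, ℝ) lam₂ x := (h₂ x).mdifferentiableAt (by simp)
  have mσ := hσ.mdiff (mdiff_extend v)
  have mτ := hτ.mdiff (mdiff_extend v)
  have hsum : (fun y ↦ alphaForm lam₁ lam₂ σ τ y (extend E v y))
      = (lam₁ * fun y ↦ σ y (extend E v y)) + lam₂ * fun y ↦ τ y (extend E v y) := by
    ext y
    simp [alphaForm]
  rw [← hd (smoothOneFormAt_alphaForm h₁ h₂ hσ hτ), hsum, mvfderiv_add (m₁.mul mσ) (m₂.mul mτ),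
    mvfderiv_mul m₁ mσ, mvfderiv_mul m₂ mτ]
  simp only [add_apply, smul_apply, hd hσ, hd hτ, extend_apply_self, smul_eq_mul]
  ring

end WittAlgebra

/-! ### The splitting of the variation field and the pointwise identity. -/

section Pointwise

variable {E : Type*} [NormedAddCommGroup E] [NormedSpace ℝ E] [FiniteDimensional ℝ E]
  {M : Type*} [TopologicalSpace M] [ChartedSpace E M] [IsManifold 𝓘(ℝ, E) ∞ M]
  {g : PseudoRiemannianMetric E M}

/-- `ξ` and `η` span the two null lines. Since each is null, orthogonal to the horizontal part and
paired to `1` with the other, the coefficient of `ξ` is read off by pairing with `η`, and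
conversely. -/
lemma WittStructure.decomposition (S : WittStructure g 1 1) (hrank : S.rank (Index.p 0) = 1)
    {x : M} {ξ η : TangentSpace 𝓘(ℝ, E) x} (hξ : ξ ∈ S.V (Index.p 0) x)
    (hη : η ∈ S.V (Index.pStar 0) x) (hξη : g.inner x ξ η = 1) (w : TangentSpace 𝓘(ℝ, E) x) :
    w = S.proj (Index.q 0) x w + g.inner x η w • ξ + g.inner x ξ w • η := by
  have hξ0 : ξ ≠ 0 := by rintro rfl; simp at hξη
  have hη0 : η ≠ 0 := by rintro rfl; simp at hξη
  have hV := S.subbundle (Index.p 0)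
  have hV' := S.subbundle (Index.pStar 0)
  rw [← S.rank_eq 0] at hV'
  rw [hrank] at hV hV'
  obtain ⟨a, ha⟩ := hV.exists_smul_eq hξ hξ0 (S.proj_mem (Index.p 0) x w)
  obtain ⟨b, hb⟩ := hV'.exists_smul_eq hη hη0 (S.proj_mem (Index.pStar 0) x w)
  have hsum : w = S.proj (Index.q 0) x w + a • ξ + b • η := by
    have h := S.sum_proj x w
    rw [Fintype.sum_sum_type, Fintype.sum_prod_type] at h
    simp only [Fin.sum_univ_one, Fintype.sum_bool] at h
    rw [ha, hb]
    refine h.symm.trans ?_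
    rw [add_assoc]
    exact congrArg _ (add_comm _ _)
  have hH := S.proj_mem (Index.q 0) x w
  have e1 : g.inner x ξ ξ = 0 := S.orthogonal _ _ (by simp [Index.star]) x _ hξ _ hξ
  have e2 : g.inner x η η = 0 := S.orthogonal _ _ (by simp [Index.star]) x _ hη _ hη
  have e3 : g.inner x ξ (S.proj (Index.q 0) x w) = 0 :=
    S.orthogonal _ _ (by simp [Index.star]) x _ hξ _ hH
  have e4 : g.inner x η (S.proj (Index.q 0) x w) = 0 :=
    S.orthogonal _ _ (by simp [Index.star]) x _ hη _ hH
  have ea : g.inner x η w = a := by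
    have h := congrArg (g.inner x η) hsum
    simp only [map_add, map_smul, smul_eq_mul, e4, e2, g.symm x η ξ, hξη] at h
    linarith
  have eb : g.inner x ξ w = b := by
    have h := congrArg (g.inner x ξ) hsum
    simp only [map_add, map_smul, smul_eq_mul, e3, e1, hξη] at h
    linarith
  rw [ea, eb]
  exact hsum

/-- The pointwise identity behind the first variation formula: `v` is the velocity of a horizontal
curve, `a` its acceleration in coordinates, and `w` the variation field. -/
lemma variation_integrand_eq (S : WittStructure g 1 1) (hrank : S.rank (Index.p 0) = 1)
    {xi xiStar : Π x : M, TangentSpace 𝓘(ℝ, E) x}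
    (hxi : ∀ x, SmoothFieldAt xi x) (hxiStar : ∀ x, SmoothFieldAt xiStar x)
    (hxi_mem : ∀ x, xi x ∈ S.V (Index.p 0) x)
    (hxiStar_mem : ∀ x, xiStar x ∈ S.V (Index.pStar 0) x)
    (hxi_inner : ∀ x, g.inner x (xi x) (xiStar x) = 1)
    {nabla : CovariantDerivative 𝓘(ℝ, E) E (TangentSpace 𝓘(ℝ, E) : M → Type _)}
    (hnabla : S.IsCanonicalConnection nabla) {lam₁ lam₂ : M → ℝ}
    (hlam₁ : ContMDiff 𝓘(ℝ, E) 𝓘(ℝ, ℝ) ∞ lam₁) (hlam₂ : ContMDiff 𝓘(ℝ, E) 𝓘(ℝ, ℝ) ∞ lam₂)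
    {x : M} {v a : TangentSpace 𝓘(ℝ, E) x} (hv : v ∈ S.V (Index.q 0) x)
    (ha : formDeriv x (g.flat xiStar) v v + g.flat xiStar x a = 0)
    (ha' : formDeriv x (g.flat xi) v v + g.flat xi x a = 0) (w : TangentSpace 𝓘(ℝ, E) x) :
    1 / 2 * tensorDeriv x g.inner w v v - tensorDeriv x g.inner v v w - g.inner x a w
        + formDeriv x (alphaForm lam₁ lam₂ (g.flat xiStar) (g.flat xi)) v w
        - formDeriv x (alphaForm lam₁ lam₂ (g.flat xiStar) (g.flat xi)) w v
      = - g.inner x (a + nabla (extend E v) x v) (S.proj (Index.q 0) x w)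
        + lam₁ x * extD (g.flat xiStar) x v (S.proj (Index.q 0) x w)
        + lam₂ x * extD (g.flat xi) x v (S.proj (Index.q 0) x w)
        + g.flat xiStar x w * (mvfderiv 𝓘(ℝ, E) lam₁ x v
          - lam₁ x * lieForm xi (g.flat xiStar) x v
          - lam₂ x * lieForm xi (g.flat xi) x v
          + 1 / 2 * lieTensor xi g.inner x v v)
        + g.flat xi x w * (mvfderiv 𝓘(ℝ, E) lam₂ x v
          - lam₁ x * lieForm xiStar (g.flat xiStar) x v
          - lam₂ x * lieForm xiStar (g.flat xi) x v
          + 1 / 2 * lieTensor xiStar g.inner x v v) := by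
  have hσ : SmoothOneFormAt (g.flat xiStar) x := g.flat_smooth (hxiStar x)
  have hτ : SmoothOneFormAt (g.flat xi) x := g.flat_smooth (hxi x)
  have hσv : g.flat xiStar x v = 0 :=
    S.orthogonal _ _ (by simp [Index.star]) x _ (hxiStar_mem x) _ hv
  have hτv : g.flat xi x v = 0 :=
    S.orthogonal _ _ (by simp [Index.star]) x _ (hxi_mem x) _ hv
  -- The pairings `σ(ξ) = 1`, `σ(ξ*) = 0`, `σ*(ξ) = 0`, `σ*(ξ*) = 1` are constant. Differentiating
  -- them along `v` turns `dσ(v, ξ)` into `-(L_ξ σ)(v)`, and similarly for the other three.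
  have c1 := formDeriv_add_of_const hσ (hxi x)
    (fun y ↦ (g.symm y _ _).trans (hxi_inner y)) v
  have c2 := formDeriv_add_of_const hσ (hxiStar x)
    (fun y ↦ S.orthogonal _ _ (by simp [Index.star]) y _ (hxiStar_mem y) _ (hxiStar_mem y)) v
  have c3 := formDeriv_add_of_const hτ (hxi x)
    (fun y ↦ S.orthogonal _ _ (by simp [Index.star]) y _ (hxi_mem y) _ (hxi_mem y)) v
  have c4 := formDeriv_add_of_const hτ (hxiStar x) hxi_inner v
  rw [formDeriv_flat g (hxiStar x)] at ha
  rw [formDeriv_flat g (hxi x)] at ha'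
  have hw := S.decomposition hrank (hxi_mem x) (hxiStar_mem x) (hxi_inner x) w
  have hH := S.proj_mem (Index.q 0) x w
  set h := S.proj (Index.q 0) x w
  -- Together `d1`, `d2`, `d3` give `½ Dg(h)(v,v) - Dg(v)(v,h) = -g(∇_v v, h)`, with `∇_v v` taken
  -- on `extend E v`: the horizontal metric part.
  have d1 := S.tensorDeriv_eq_nabla_extend hnabla h v v
  have d2 := S.tensorDeriv_eq_nabla_extend hnabla v v h
  have d3 := S.inner_nabla_extend_symm hnabla hH hv hv
  have s1 : ∀ u y z, tensorDeriv x g.inner u y z = tensorDeriv x g.inner u z y := fun u y z ↦ by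
    rw [S.tensorDeriv_eq_nabla_extend hnabla, S.tensorDeriv_eq_nabla_extend hnabla,
      g.symm x (nabla (extend E y) x u), g.symm x y, add_comm]
  rw [formDeriv_alphaForm hlam₁ hlam₂ hσ hτ, formDeriv_alphaForm hlam₁ hlam₂ hσ hτ, hσv, hτv,
    lieForm_eq_formDeriv hσ, lieForm_eq_formDeriv hσ, lieForm_eq_formDeriv hτ,
    lieForm_eq_formDeriv hτ, extD_eq_formDeriv hσ, extD_eq_formDeriv hτ,
    lieTensor_eq_tensorDeriv g.smooth, lieTensor_eq_tensorDeriv g.smooth]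
  have hA : g.flat xiStar x w = g.inner x (xiStar x) w := rfl
  have hB : g.flat xi x w = g.inner x (xi x) w := rfl
  have haA : g.flat xiStar x a = g.inner x a (xiStar x) := g.symm x _ _
  have haB : g.flat xi x a = g.inner x a (xi x) := g.symm x _ _
  rw [haA, s1] at ha
  rw [haB, s1] at ha'
  rw [g.symm x (coordDeriv x xiStar v)] at ha
  rw [g.symm x (coordDeriv x xi v)] at ha'
  rw [g.symm x v (nabla _ _ _)] at d1
  rw [g.symm x v (nabla _ _ _)] at d2
  rw [g.symm x (coordDeriv x xi v) v, g.symm x (coordDeriv x xiStar v) v, hA, hB]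
  -- The coefficients of the splitting themselves contain `w`, so they are frozen before `w` is
  -- expanded.
  generalize g.inner x (xiStar x) w = A at *
  generalize g.inner x (xi x) w = B at *
  rw [hw]
  simp only [map_add, map_smul, add_apply, smul_apply, smul_eq_mul]
  -- `d1`, `d2`, `d3` settle the horizontal direction; `ha'` and `ha` eliminate `g(a, ξ)` and `g(a,
  -- ξ*)`; `c1` to `c4` convert the exterior derivatives into Lie derivatives.
  linear_combination 1 / 2 * d1 - d2 + d3 - B * ha - A * ha' + lam₁ x * A * c1
    + lam₁ x * B * c2 + lam₂ x * A * c3 + lam₂ x * B * c4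

end Pointwise

/-! ### Regularity of the integrands and identification of the velocity and variation fields. -/

section Smoothness

open MeasureTheory

variable {E : Type*} [NormedAddCommGroup E] [NormedSpace ℝ E] [FiniteDimensional ℝ E]
  {M : Type*} [TopologicalSpace M] [ChartedSpace E M] [IsManifold 𝓘(ℝ, E) ∞ M]
  {f : ℝ × ℝ → M} {Ω : Set (ℝ × ℝ)} {α : Π x : M, TangentSpace 𝓘(ℝ, E) x →L[ℝ] ℝ}
  {g : Π x : M, TangentSpace 𝓘(ℝ, E) x →L[ℝ] TangentSpace 𝓘(ℝ, E) x →L[ℝ] ℝ}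

/-- This field is the tangent map of `f` composed with the constant section `z ↦ (z, d)`. -/
lemma contMDiffOn_partialField (hf : ContMDiffOn 𝓘(ℝ, ℝ × ℝ) 𝓘(ℝ, E) ∞ f Ω)
    (hΩ : UniqueDiffOn ℝ Ω) (d : ℝ × ℝ) :
    ContMDiffOn 𝓘(ℝ, ℝ × ℝ) 𝓘(ℝ, E).tangent ∞
      (fun z ↦ (⟨f z, partialField f Ω d z⟩ : TangentBundle 𝓘(ℝ, E) M)) Ω := by
  have h1 := hf.contMDiffOn_tangentMapWithin (m := ∞) (by simp) hΩ.uniqueMDiffOn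
  have h2 : ContMDiffOn 𝓘(ℝ, ℝ × ℝ) 𝓘(ℝ, ℝ × ℝ).tangent ∞
      (fun z : ℝ × ℝ ↦ (⟨z, d⟩ : TangentBundle 𝓘(ℝ, ℝ × ℝ) (ℝ × ℝ))) Ω :=
    contMDiffOn_vectorSpace_iff_contDiffOn.2 contDiffOn_const
  exact h1.comp h2 fun z hz ↦ hz

lemma contDiffOn_form_partialField (hf : ContMDiffOn 𝓘(ℝ, ℝ × ℝ) 𝓘(ℝ, E) ∞ f Ω)
    (hΩ : UniqueDiffOn ℝ Ω) (hα : ∀ x, SmoothOneFormAt α x) (d : ℝ × ℝ) :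
    ContDiffOn ℝ 1 (fun z ↦ α (f z) (partialField f Ω d z)) Ω := by
  intro z hz
  have h1 : ContMDiffWithinAt 𝓘(ℝ, ℝ × ℝ) (𝓘(ℝ, E).prod 𝓘(ℝ, ℝ)) ∞
      (fun z ↦ TotalSpace.mk' ℝ (E := Bundle.Trivial M ℝ) (f z) (α (f z) (partialField f Ω d z)))
      Ω z :=
    ContMDiffWithinAt.clm_bundle_apply (F₁ := E) ((hα (f z)).comp_contMDiffWithinAt z (hf z hz))
      (contMDiffOn_partialField hf hΩ d z hz)
  exact ((contMDiffWithinAt_totalSpace.1 h1).2.contDiffWithinAt).of_le (by norm_cast)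

lemma contDiffOn_tensor_partialField (hf : ContMDiffOn 𝓘(ℝ, ℝ × ℝ) 𝓘(ℝ, E) ∞ f Ω)
    (hΩ : UniqueDiffOn ℝ Ω) (hg : SmoothTwoTensor g) (d d' : ℝ × ℝ) :
    ContDiffOn ℝ 1 (fun z ↦ g (f z) (partialField f Ω d z) (partialField f Ω d' z)) Ω := by
  intro z hz
  have h1 : ContMDiffWithinAt 𝓘(ℝ, ℝ × ℝ) (𝓘(ℝ, E).prod 𝓘(ℝ, ℝ)) ∞
      (fun z ↦ TotalSpace.mk' ℝ (E := Bundle.Trivial M ℝ) (f z)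
        (g (f z) (partialField f Ω d z) (partialField f Ω d' z))) Ω z :=
    ContMDiffWithinAt.clm_bundle_apply₂ (F₁ := E) (F₂ := E)
      ((hg (f z)).comp_contMDiffWithinAt z (hf z hz))
      (contMDiffOn_partialField hf hΩ d z hz) (contMDiffOn_partialField hf hΩ d' z hz)
  exact ((contMDiffWithinAt_totalSpace.1 h1).2.contDiffWithinAt).of_le (by norm_cast)

variable {ε : ℝ} {F : ℝ → ℝ → M}

/-- The domain of a variation. -/
abbrev variationDomain (ε : ℝ) : Set (ℝ × ℝ) := Ioo (-ε) ε ×ˢ Icc 0 1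

/-- Chain rule along the slice `t ↦ (s, t)`, taken within the closed strip so that the endpoints `t
= 0, 1` are included. -/
lemma velocity_eq_partialField (hF : IsVariation E ε F) {s t : ℝ} (hs : s ∈ Ioo (-ε) ε)
    (ht : t ∈ Icc (0 : ℝ) 1) :
    velocity (E := E) (F s) t
      = partialField (fun z ↦ F z.1 z.2) (variationDomain ε) (0, 1) (s, t) := by
  have hd : HasFDerivWithinAt (fun t : ℝ ↦ (s, t)) (ContinuousLinearMap.inr ℝ ℝ ℝ) (Icc 0 1) t :=
    (hasFDerivAt_prodMk_right s t).hasFDerivWithinAt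
  have h1 : MDifferentiableWithinAt 𝓘(ℝ, ℝ × ℝ) 𝓘(ℝ, E) (fun z : ℝ × ℝ ↦ F z.1 z.2)
      (variationDomain ε) (s, t) := (hF.2.1 (s, t) ⟨hs, ht⟩).mdifferentiableWithinAt (by simp)
  have hu : UniqueMDiffWithinAt 𝓘(ℝ, ℝ) (Icc (0 : ℝ) 1) t :=
    (uniqueDiffOn_Icc zero_lt_one).uniqueMDiffOn t ht
  have h := mfderivWithin_comp t (f := fun t : ℝ ↦ (s, t)) h1
    hd.differentiableWithinAt.mdifferentiableWithinAt (fun u hu ↦ ⟨hs, hu⟩) hu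
  have h2 : mfderivWithin 𝓘(ℝ, ℝ) 𝓘(ℝ, ℝ × ℝ) (fun t : ℝ ↦ (s, t)) (Icc 0 1) t
      = ContinuousLinearMap.inr ℝ ℝ ℝ := by
    rw [mfderivWithin_eq_fderivWithin]
    exact hd.fderivWithin (uniqueDiffOn_Icc zero_lt_one t ht)
  rw [h2] at h
  exact congrArg (fun T : ℝ →L[ℝ] E ↦ T 1) h

lemma variationField_eq_partialField (hF : IsVariation E ε F) {t : ℝ} (ht : t ∈ Icc (0 : ℝ) 1) :
    variationField (E := E) F t
      = partialField (fun z ↦ F z.1 z.2) (variationDomain ε) (1, 0) (0, t) := by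
  have h0 : (0 : ℝ) ∈ Ioo (-ε) ε := by simp [hF.1]
  have hn : Ioo (-ε) ε ∈ 𝓝 (0 : ℝ) := isOpen_Ioo.mem_nhds h0
  have hd : HasFDerivWithinAt (fun s : ℝ ↦ (s, t)) (ContinuousLinearMap.inl ℝ ℝ ℝ)
      (Ioo (-ε) ε) 0 := (hasFDerivAt_prodMk_left 0 t).hasFDerivWithinAt
  have h1 : MDifferentiableWithinAt 𝓘(ℝ, ℝ × ℝ) 𝓘(ℝ, E) (fun z : ℝ × ℝ ↦ F z.1 z.2)
      (variationDomain ε) (0, t) := (hF.2.1 (0, t) ⟨h0, ht⟩).mdifferentiableWithinAt (by simp)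
  have h := mfderivWithin_comp 0 (f := fun s : ℝ ↦ (s, t)) h1
    hd.differentiableWithinAt.mdifferentiableWithinAt (fun u hu ↦ ⟨hu, ht⟩)
    (isOpen_Ioo.uniqueDiffOn.uniqueMDiffOn 0 h0)
  have h2 : mfderivWithin 𝓘(ℝ, ℝ) 𝓘(ℝ, ℝ × ℝ) (fun s : ℝ ↦ (s, t)) (Ioo (-ε) ε) 0
      = ContinuousLinearMap.inl ℝ ℝ ℝ := by
    rw [mfderivWithin_eq_fderivWithin]
    exact hd.fderivWithin (isOpen_Ioo.uniqueDiffOn 0 h0)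
  rw [h2, mfderivWithin_of_mem_nhds hn] at h
  exact congrArg (fun T : ℝ →L[ℝ] E ↦ T 1) h

lemma variationField_eq_zero {t : ℝ} (h : ∀ᶠ s in 𝓝 (0 : ℝ), F s t = F 0 t) :
    variationField (E := E) F t = 0 := by
  have h1 : (fun s ↦ F s t) =ᶠ[𝓝 0] fun _ ↦ F 0 t := h
  have h2 : mfderiv 𝓘(ℝ, ℝ) 𝓘(ℝ, E) (fun s ↦ F s t) 0 = (0 : ℝ →L[ℝ] E) :=
    h1.mfderiv_eq.trans mfderiv_const
  exact congrArg (fun T : ℝ →L[ℝ] E ↦ T 1) h2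

lemma derivWithin_comp_curve {c : ℝ → M} {t : ℝ} (ht : t ∈ Icc (0 : ℝ) 1) {h : M → ℝ}
    (hh : MDifferentiableAt 𝓘(ℝ, E) 𝓘(ℝ, ℝ) h (c t))
    (hc : MDifferentiableWithinAt 𝓘(ℝ, ℝ) 𝓘(ℝ, E) c (Icc 0 1) t) :
    derivWithin (fun u ↦ h (c u)) (Icc 0 1) t = mvfderiv 𝓘(ℝ, E) h (c t) (velocity c t) := by
  have h1 := mfderiv_comp_mfderivWithin t hh hc
    ((uniqueDiffOn_Icc (zero_lt_one (α := ℝ))).uniqueMDiffOn t ht)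
  rw [mfderivWithin_eq_fderivWithin] at h1
  exact congrArg (fun T : ℝ →L[ℝ] ℝ ↦ T 1) h1

lemma energyWithForm_eq_integral (g : PseudoRiemannianMetric E M) (hF : IsVariation E ε F)
    (hα : ∀ x, SmoothOneFormAt α x) {s : ℝ} (hs : s ∈ Ioo (-ε) ε) :
    energyWithForm g α (F s) = ∫ t in (0 : ℝ)..1, ((1 / 2 : ℝ) * g.inner (F s t)
        (partialField (fun z ↦ F z.1 z.2) (variationDomain ε) (0, 1) (s, t))
        (partialField (fun z ↦ F z.1 z.2) (variationDomain ε) (0, 1) (s, t))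
      - α (F s t) (partialField (fun z ↦ F z.1 z.2) (variationDomain ε) (0, 1) (s, t))) := by
  have hi : ∀ {e : ℝ × ℝ → ℝ}, ContDiffOn ℝ 1 e (variationDomain ε) →
      IntervalIntegrable (fun t ↦ e (s, t)) volume 0 1 := fun he ↦ by
    apply ContinuousOn.intervalIntegrable
    rw [uIcc_of_le zero_le_one]
    exact he.continuousOn.comp (f := fun t : ℝ ↦ (s, t)) (by fun_prop) fun t ht ↦ ⟨hs, ht⟩
  have h1 := hi (contDiffOn_tensor_partialField hF.2.1 uniqueDiffOn_Ioo_prod_Icc g.smooth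
    (0, 1) (0, 1))
  have h2 := hi (contDiffOn_form_partialField hF.2.1 uniqueDiffOn_Ioo_prod_Icc hα (0, 1))
  rw [intervalIntegral.integral_sub (h1.const_mul _) h2, intervalIntegral.integral_const_mul,
    energyWithForm, energy]
  congr 1
  · congr 1
    refine intervalIntegral.integral_congr fun t ht ↦ ?_
    rw [uIcc_of_le zero_le_one] at ht
    simp only [velocity_eq_partialField hF hs ht]
  · refine intervalIntegral.integral_congr fun t ht ↦ ?_
    rw [uIcc_of_le zero_le_one] at ht
    simp only [velocity_eq_partialField hF hs ht]

end Smoothness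

end Witt

end

/-! ### The first variation formula. -/

open Witt in
theorem proposition4p2
    {E : Type*} [NormedAddCommGroup E] [NormedSpace ℝ E] [FiniteDimensional ℝ E]
    {M : Type*} [TopologicalSpace M] [ChartedSpace E M] [IsManifold 𝓘(ℝ, E) ∞ M] [T2Space M]
    (g : PseudoRiemannianMetric E M)
    -- a Witt structure `TM = (V_p ⊕ V_p^*) ⊕ V_q`, with line bundles `V_p`, `V_p^*`
    (S : WittStructure g 1 1) (hrank : S.rank (Index.p 0) = 1)
    (hpos : ∀ x, ∀ v ∈ S.V (Index.q 0) x, v ≠ 0 → 0 < g.inner x v v)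
    -- a global frame `ξ, ξ^*` of `V_p ⊕ V_p^*`
    (xi xiStar : Π x : M, TangentSpace 𝓘(ℝ, E) x)
    (hxi : ∀ x, SmoothFieldAt xi x) (hxiStar : ∀ x, SmoothFieldAt xiStar x)
    (hxi_mem : ∀ x, xi x ∈ S.V (Index.p 0) x)
    (hxiStar_mem : ∀ x, xiStar x ∈ S.V (Index.pStar 0) x)
    (hxi_inner : ∀ x, g.inner x (xi x) (xiStar x) = 1)
    -- the canonical Witt connection
    (nabla : CovariantDerivative 𝓘(ℝ, E) E (TangentSpace 𝓘(ℝ, E) : M → Type _))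
    (hnabla : S.IsCanonicalConnection nabla)
    -- `λ = (λ₁, λ₂)`
    (lam₁ lam₂ : M → ℝ)
    (hlam₁ : ContMDiff 𝓘(ℝ, E) 𝓘(ℝ, ℝ) ∞ lam₁) (hlam₂ : ContMDiff 𝓘(ℝ, E) 𝓘(ℝ, ℝ) ∞ lam₂)
    -- a variation of the horizontal curve `c = F 0`
    (ε : ℝ) (F : ℝ → ℝ → M) (hF : IsVariation E ε F)
    (hc : IsHorizontalCurve (S.V (Index.q 0)) (F 0)) :
    let sigma := g.flat xiStar
    let sigmaStar := g.flat xi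
    let c : ℝ → M := F 0
    let dc : Π t, TangentSpace 𝓘(ℝ, E) (c t) := velocity c
    let w : Π t, TangentSpace 𝓘(ℝ, E) (c t) := variationField F
    let wH : Π t, TangentSpace 𝓘(ℝ, E) (c t) := fun t ↦ S.proj (Index.q 0) (c t) (w t)
    let l₁ : ℝ → ℝ := fun t ↦ lam₁ (c t)
    let l₂ : ℝ → ℝ := fun t ↦ lam₂ (c t)
    let integrand : ℝ → ℝ := fun t ↦
      - g.inner (c t) (covDerivAlong nabla c dc t) (wH t)
      + l₁ t * extD sigma (c t) (dc t) (wH t)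
      + l₂ t * extD sigmaStar (c t) (dc t) (wH t)
      + sigma (c t) (w t) *
        (derivWithin l₁ (Set.Icc 0 1) t
          - l₁ t * lieForm xi sigma (c t) (dc t)
          - l₂ t * lieForm xi sigmaStar (c t) (dc t)
          + 1 / 2 * lieTensor xi g.inner (c t) (dc t) (dc t))
      + sigmaStar (c t) (w t) *
        (derivWithin l₂ (Set.Icc 0 1) t
          - l₁ t * lieForm xiStar sigma (c t) (dc t)
          - l₂ t * lieForm xiStar sigmaStar (c t) (dc t)
          + 1 / 2 * lieTensor xiStar g.inner (c t) (dc t) (dc t))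
    IntervalIntegrable integrand MeasureTheory.volume 0 1 ∧
    HasDerivAt (fun u ↦ energyWithForm g (alphaForm lam₁ lam₂ sigma sigmaStar) (F u))
      (∫ t in (0 : ℝ)..1, integrand t) 0 := by
  intro sigma sigmaStar c dc w wH l₁ l₂ integrand
  set Ω := variationDomain ε with hΩdef
  set f : ℝ × ℝ → M := fun z ↦ F z.1 z.2 with hf
  have hfΩ : ContMDiffOn 𝓘(ℝ, ℝ × ℝ) 𝓘(ℝ, E) ∞ f Ω := hF.2.1
  have h0 : (0 : ℝ) ∈ Ioo (-ε) ε := by simp [hF.1]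
  have hu : UniqueDiffOn ℝ Ω := uniqueDiffOn_Ioo_prod_Icc
  have hσ : ∀ x, SmoothOneFormAt sigma x := fun x ↦ g.flat_smooth (hxiStar x)
  have hτ : ∀ x, SmoothOneFormAt sigmaStar x := fun x ↦ g.flat_smooth (hxi x)
  have hα : ∀ x, SmoothOneFormAt (alphaForm lam₁ lam₂ sigma sigmaStar) x := fun x ↦
    smoothOneFormAt_alphaForm hlam₁ hlam₂ (hσ x) (hτ x)
  have hw : ∀ t ∈ Icc (0 : ℝ) 1, w t = partialField f Ω (1, 0) (0, t) := fun t ht ↦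
    variationField_eq_partialField hF ht
  have hdc : ∀ t ∈ Icc (0 : ℝ) 1, dc t = partialField f Ω (0, 1) (0, t) := fun t ht ↦
    velocity_eq_partialField hF h0 ht
  -- The boundary term is linear in `w`, and `w` vanishes where the variation is stationary in `s`.
  have hend : ∀ t ∈ Icc (0 : ℝ) 1, (∀ s ∈ Ioo (-ε) ε, F s t = F 0 t) →
      g.inner (f (0, t)) (partialField f Ω (0, 1) (0, t)) (partialField f Ω (1, 0) (0, t))
        - alphaForm lam₁ lam₂ sigma sigmaStar (f (0, t)) (partialField f Ω (1, 0) (0, t)) = 0 := by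
    intro t ht h
    have hz : partialField f Ω (1, 0) (0, t) = (0 : TangentSpace 𝓘(ℝ, E) (f (0, t))) :=
      (hw t ht).symm.trans (variationField_eq_zero
        (Filter.mem_of_superset (isOpen_Ioo.mem_nhds h0) h))
    rw [hz, map_zero, map_zero, sub_zero]
  have key := hasDerivAt_integral_of_boundary (φ := integrand) hF.1
    (e := fun z ↦ (1 / 2 : ℝ) * g.inner (f z) (partialField f Ω (0, 1) z)
        (partialField f Ω (0, 1) z)
      - alphaForm lam₁ lam₂ sigma sigmaStar (f z) (partialField f Ω (0, 1) z))
    (b := fun z ↦ g.inner (f z) (partialField f Ω (0, 1) z) (partialField f Ω (1, 0) z)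
      - alphaForm lam₁ lam₂ sigma sigmaStar (f z) (partialField f Ω (1, 0) z))
    ((contDiffOn_const.mul (contDiffOn_tensor_partialField hfΩ hu g.smooth _ _)).sub
      (contDiffOn_form_partialField hfΩ hu hα _))
    ((contDiffOn_tensor_partialField hfΩ hu g.smooth _ _).sub
      (contDiffOn_form_partialField hfΩ hu hα _))
    (hend 0 (by simp) fun s hs ↦ (hF.2.2 s hs).1)
    (hend 1 (by simp) fun s hs ↦ (hF.2.2 s hs).2) ?_
  · refine ⟨key.1, key.2.congr_of_eventuallyEq ?_⟩
    filter_upwards [isOpen_Ioo.mem_nhds h0] with s hs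
    exact energyWithForm_eq_integral g hF hα hs
  intro t ht
  have ht' := Ioo_subset_Icc_self ht
  have hΩ : Ω ∈ 𝓝 ((0 : ℝ), t) :=
    prod_mem_nhds (isOpen_Ioo.mem_nhds h0) (Icc_mem_nhds ht.1 ht.2)
  have hhor : ∀ u ∈ Icc (0 : ℝ) 1,
      partialField f Ω (0, 1) (0, u) ∈ S.V (Index.q 0) (f (0, u)) := fun u hu ↦ by
    rw [← hdc u hu]
    exact hc.2 u hu
  -- An index `Sum.inr k` is `p` or `p*`, so this covers both `σ*` and `σ`. Vanishing near `t`, not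
  -- just at `t`, is what allows differentiation along the curve.
  have hker : ∀ {X : Π x : M, TangentSpace 𝓘(ℝ, E) x} {k : Fin 1 × Bool},
      (∀ x, X x ∈ S.V (Sum.inr k) x) → ∀ᶠ u in 𝓝 t,
        g.flat X (f (0, u)) (partialField f Ω (0, 1) (0, u)) = 0 := by
    intro X k hX
    filter_upwards [Icc_mem_nhds ht.1 ht.2] with u hu
    exact S.orthogonal _ _ (by simp [Index.star]) _ _ (hX _) _ (hhor u hu)
  rw [fderiv_lagrangian_sub hfΩ hΩ g.smooth g.symm (hα _) rfl rfl,
    variation_integrand_eq S hrank hxi hxiStar hxi_mem hxiStar_mem hxi_inner hnabla hlam₁ hlam₂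
      (hhor t ht') (formDeriv_add_accel_eq_zero hfΩ hΩ (hσ _) rfl (hker hxiStar_mem))
      (formDeriv_add_accel_eq_zero hfΩ hΩ (hτ _) rfl (hker hxi_mem))]
  have hcov : covDerivAlong nabla c dc t = coordAccel f (0, t)
      + nabla (extend E (partialField f Ω (0, 1) (0, t))) (f (0, t))
        (partialField f Ω (0, 1) (0, t)) :=
    covDerivAlong_eq_coordAccel nabla hfΩ hΩ ht fun u hu ↦ hdc u (Ioo_subset_Icc_self hu)
  have hcd : MDifferentiableWithinAt 𝓘(ℝ, ℝ) 𝓘(ℝ, E) c (Icc 0 1) t :=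
    (hc.1 t ht').mdifferentiableWithinAt (by simp)
  have hl₁ : derivWithin l₁ (Icc 0 1) t
      = mvfderiv 𝓘(ℝ, E) lam₁ (f (0, t)) (partialField f Ω (0, 1) (0, t)) := by
    rw [← hdc t ht']
    exact derivWithin_comp_curve ht' ((hlam₁ _).mdifferentiableAt (by simp)) hcd
  have hl₂ : derivWithin l₂ (Icc 0 1) t
      = mvfderiv 𝓘(ℝ, E) lam₂ (f (0, t)) (partialField f Ω (0, 1) (0, t)) := by
    rw [← hdc t ht']
    exact derivWithin_comp_curve ht' ((hlam₂ _).mdifferentiableAt (by simp)) hcd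
  simp only [integrand, wH]
  rw [hcov, hl₁, hl₂, hdc t ht', hw t ht']
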